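/- **Model.** Let $\mathcal N,\mathcal K,\mathcal F$ be finite sets of edge servers, users and files ($\mathcal N,\mathcal F$ nonempty). Each user is served by exactly one server; $\mathcal K_n$ is the set of users of server $n$ and $K_n=|\mathcal K_n|$. File $f$ has integer size $L_f$, server $n$ has integer capacity $M_n$ and storage cost budget $b_n\ge 0$, and $\alpha>0$ is the unit storage cost. In slot $t=0,1,\dots$ user $k$ requests file $f$ iff $\theta_{k,f}(t)=1$ ($\theta_{k,f}(t)\in\{0,1\}$), and $D_{n,f}(t)=\sum_{k\in\mathcal K_n}\theta_{k,f}(t)$. The matrices $(D_{n,f}(t))_{n,f}$ are i.i.d. over $t$ (arbitrarily dependent within a slot). For each $(n,f)$ there are $H_{n,f}\ge 0$ offline observations $D^h_{n,f}(s)$, $0\le s<H_{n,f}$, i.i.d. with the law of $D_{n,f}(0)$; the offline data are independent of the online demands. A placement $X_n(t)\in\{0,1\}^{\mathcal F}$ must satisfy $\sum_f L_fX_{n,f}(t)\le M_n$; it costs $C_n(t)=\alpha\sum_f L_fX_{n,f}(t)$ and earns $R_n(t)=\sum_f L_fD_{n,f}(t)X_{n,f}(t)$. **Regret.** A scheme is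 feasible if it respects the capacities, chooses $X(t)$ (possibly at random) before the demands of slot $t$ are revealed, i.e. $D(t)$ is independent of $((D(s))_{s<t},(X(s))_{s\le t})$, and satisfies $\limsup_{t\to\infty}\frac1t\sum_{\tau<t}\mathbb E[C_n(\tau)]\le b_n$ for all $n$. Let $R^*$ be the supremum over feasible schemes of the long-run average reward $\limsup_{t\to\infty}\frac1t\sum_{\tau<t}\sum_n\mathbb E[R_n(\tau)]$. The regret over horizon $T$ of placements $X$ is $Reg(T)=R^*-\frac1T\sum_{t=0}^{T-1}\sum_n\mathbb E[R_n(t)]$. **CPHBL.** Let $V>0$ and $Q_n(0)=0$. In slot $t$ put $h_{n,f}(t)=\sum_{\tau<t}X_{n,f}(\tau)$ and $$\bar d_{n,f}(t)=\frac{\sum_{\tau<t}D_{n,f}(\tau)X_{n,f}(\tau)+\sum_{s<H_{n,f}}D^h_{n,f}(s)}{h_{n,f}(t)+H_{n,f}},\qquad \tilde d_{n,f}(t)=\min\Big\{\bar d_{n,f}(t)+K_n\sqrt{\tfrac{3\log t}{2(h_{n,f}(t)+H_{n,f})}},\,K_n\Big\}$$ if $t>0$ and $h_{n,f}(t)+H_{n,f}>0$,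 and $\tilde d_{n,f}(t)=K_n$ otherwise. For each $n$, $X_n(t)$ is an optimal solution (ties being broken by any fixed rule that may depend on $t$, $n$ and the weights, for example by dynamic programming) of the problem of maximizing $\sum_f L_f(V\tilde d_{n,f}(t)-\alpha Q_n(t))x_f$ over $x\in\{0,1\}^{\mathcal F}$ with $\sum_fL_fx_f\le M_n$. Then $Q_n(t+1)=\max\{Q_n(t)-b_n,0\}+C_n(t)$. **Theorem.** Under CPHBL, for every $T\ge 1$, $$Reg(T)\le \frac BV+\frac{4\sum_{n}K_nM_n}{T}+\varGamma\sqrt{\frac{\log T}{T+H_{\min}}},$$ where $B=\sum_n (b_n^2+\alpha^2M_n^2)/2$, $\varGamma=2\sum_nK_n\sqrt{6M_n\sum_fL_f}$ and $H_{\min}=\min_{n,f}H_{n,f}$. -/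

import Mathlib

open MeasureTheory ProbabilityTheory Filter

noncomputable section

namespace FogCache

/-- A fog caching system with edge servers `N`, users `U` and files `F`: every user `k` is served
by exactly one edge server `serve k`; file `f` has size `size f`, server `n` has capacity `cap n`,
`unitCost` is the cost of storing one unit during one slot, `budget n` is the storage cost
budget of server `n`, and `hist n f` is the number of offline observations of the demand for
file `f` on server `n`. -/
structure System (N U F : Type*) where
  serve : U → N
  size : F → ℕ
  cap : N → ℕ
  unitCost : ℝ
  budget : N → ℝ
  hist : N → F → ℕ

section Model

variable {N U F : Type*} [Fintype N] [Fintype U] [Fintype F] [DecidableEq N] [DecidableEq F]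

namespace System

/-- The number `K_n` of users served by server `n`. -/
def numUsers (sys : System N U F) (n : N) : ℕ :=
  (Finset.univ.filter fun k => sys.serve k = n).card

/-- The number of users of server `n` that request file `f`, when `req k f` tells
whether user `k` requests file `f`. -/
def demand (sys : System N U F) (req : U → F → Bool) (n : N) (f : F) : ℕ :=
  ∑ k ∈ Finset.univ.filter (fun k => sys.serve k = n), (req k f).toNat

/-- A placement `x` (`x f = true` iff file `f` is cached) respects the capacity of server `n`. -/
def Fits (sys : System N U F) (n : N) (x : F → Bool) : Prop :=
  ∑ f, sys.size f * (x f).toNat ≤ sys.cap n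

/-- Storage cost of a placement during one slot. -/
def cost (sys : System N U F) (x : F → Bool) : ℝ :=
  ∑ f, sys.unitCost * sys.size f * (x f).toNat

/-- Cache hit reward of server `n` under placement `x` and demand matrix `D`. -/
def reward (sys : System N U F) (n : N) (D : N → F → ℕ) (x : F → Bool) : ℝ :=
  ∑ f, (sys.size f : ℝ) * D n f * (x f).toNat

/-- The minimal number of offline observations. -/
def histMin (sys : System N U F) : ℕ := ⨅ p : N × F, sys.hist p.1 p.2

end System

/-! ### Stochastic assumptions -/

/-- `θ t k f` tells whether user `k` requests file `f` in slot `t`, and `Dh n f s` is the `s`-th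
offline observation of the demand for file `f` on server `n`. The demand matrices are i.i.d. over
time (with arbitrary dependence inside a slot); for each server and file the offline observations
are i.i.d. with the law of the demand for this file on this server; the offline data are
independent of the online demands. -/
structure IsDemandModel (sys : System N U F) {Ω : Type*} [MeasurableSpace Ω] (P : Measure Ω)
    (θ : ℕ → U → F → Ω → Bool) (Dh : (n : N) → (f : F) → Fin (sys.hist n f) → Ω → ℕ) : Prop where
  measurable_request : ∀ t k f, Measurable (θ t k f)
  measurable_offline : ∀ n f s, Measurable (Dh n f s)
  indep_online : iIndepFun (fun t ω => sys.demand fun k f => θ t k f ω) P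
  identDistrib_online : ∀ t, IdentDistrib (fun ω => sys.demand fun k f => θ t k f ω)
    (fun ω => sys.demand fun k f => θ 0 k f ω) P P
  indep_offline : ∀ n f, iIndepFun (Dh n f) P
  identDistrib_offline : ∀ n f s, IdentDistrib (Dh n f s)
    (fun ω => sys.demand (fun k f => θ 0 k f ω) n f) P P
  indep_offline_online : IndepFun (fun ω n f s => Dh n f s ω)
    (fun ω (t : ℕ) => sys.demand fun k f => θ t k f ω) P

/-! ### The optimal time-averaged reward -/

/-- A (possibly randomized) cache placement scheme `X`, acting on a demand process `D` whose
slots are distributed according to `μ`, is feasible if it always respects the capacities, makes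
the decision of slot `t` before the demand of slot `t` is revealed, and meets the time-averaged
storage cost constraints. -/
structure IsFeasibleScheme (sys : System N U F) (μ : Measure (N → F → ℕ))
    {Ω : Type} [MeasurableSpace Ω] (P : Measure Ω)
    (D : ℕ → Ω → N → F → ℕ) (X : ℕ → Ω → N → F → Bool) : Prop where
  measurable_demand : ∀ t, Measurable (D t)
  measurable_placement : ∀ t, Measurable (X t)
  law : ∀ t, P.map (D t) = μ
  causal : ∀ t, IndepFun (D t)
    (fun ω => ((fun s : Fin t => D s ω), (fun s : Fin (t + 1) => X s ω))) P
  fits : ∀ t ω n, sys.Fits n (X t ω n)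
  budget_le : ∀ n, limsup (fun t : ℕ =>
    (1 / (t : ℝ)) * ∑ τ ∈ Finset.range t, ∫ ω, sys.cost (X τ ω n) ∂P) atTop ≤ sys.budget n

/-- `R*`: the optimal time-averaged total expected reward over all feasible schemes, when the
demand of a slot has law `μ`. -/
def optReward (sys : System N U F) (μ : Measure (N → F → ℕ)) : ℝ :=
  sSup {v : ℝ | ∃ (Ω : Type) (_ : MeasurableSpace Ω) (P : Measure Ω) (_ : IsProbabilityMeasure P)
    (D : ℕ → Ω → N → F → ℕ) (X : ℕ → Ω → N → F → Bool), IsFeasibleScheme sys μ P D X ∧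
    v = limsup (fun t : ℕ => (1 / (t : ℝ)) * ∑ τ ∈ Finset.range t, ∑ n,
      ∫ ω, sys.reward n (D τ ω) (X τ ω n) ∂P) atTop}

/-- The regret over horizon `T`, relative to `R*`, of the placements `X` under demands `D`. -/
def regret (sys : System N U F) {Ω : Type*} [MeasurableSpace Ω] (P : Measure Ω)
    (D : ℕ → Ω → N → F → ℕ) (X : ℕ → Ω → N → F → Bool) (T : ℕ) : ℝ :=
  optReward sys (P.map (D 0)) -
    (1 / (T : ℝ)) * ∑ t ∈ Finset.range T, ∑ n, ∫ ω, sys.reward n (D t ω) (X t ω n) ∂P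

end Model

/-! ### The one-slot placement problem -/

section Placement

variable {N U F : Type*} [Fintype F] [DecidableEq F]

/-- `x` is an optimal solution of the one-slot problem of server `n`: maximize the total weight
subject to the capacity constraint. -/
def IsOptimalPlacement (sys : System N U F) (n : N) (w : F → ℝ) (x : F → Bool) : Prop :=
  sys.Fits n x ∧ ∀ y, sys.Fits n y → ∑ f, w f * (y f).toNat ≤ ∑ f, w f * (x f).toNat

/-- The dynamic programming table of the knapsack problem. -/
def dpValue (L : F → ℕ) (w : F → ℝ) : List F → ℕ → ℝ
  | [], _ => 0
  | f :: l, m =>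
    if m < L f then dpValue L w l m
    else max (dpValue L w l m) (dpValue L w l (m - L f) + w f)

open Classical in
/-- The placement read off from the dynamic programming table. -/
def dpPlacement (L : F → ℕ) (w : F → ℝ) : List F → ℕ → F → Bool
  | [], _ => fun _ => false
  | f :: l, m =>
    if dpValue L w (f :: l) m = dpValue L w l (m - L f) + w f ∧ L f ≤ m then
      Function.update (dpPlacement L w l (m - L f)) f true
    else dpPlacement L w l m

/-- The dynamic programming subroutine: files of negative weight are not cached, and the remaining
files, enumerated by `order`, are placed by dynamic programming. -/
def setCachePlacement (sys : System N U F) (order : Finset F → List F) (n : N) (w : F → ℝ) :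
    F → Bool :=
  dpPlacement sys.size w (order (Finset.univ.filter fun f => 0 ≤ w f)) (sys.cap n)

set_option linter.unusedSectionVars false in
theorem dpPlacement_eq_false (L : F → ℕ) (w : F → ℝ) (l : List F) (m : ℕ) (f : F) (hf : f ∉ l) :
    dpPlacement L w l m f = false := by
  induction l generalizing m with
  | nil => rfl
  | cons g l ih =>
    rw [List.mem_cons, not_or] at hf
    unfold dpPlacement
    split_ifs
    · rw [Function.update_of_ne hf.1]; exact ih _ hf.2
    · exact ih _ hf.2

theorem sum_update_true {β : Type*} [AddCommMonoid β] (c : F → Bool → β) (hc : ∀ f, c f false = 0)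
    (x : F → Bool) (f : F) (hf : x f = false) :
    ∑ g, c g (Function.update x f true g) = (∑ g, c g (x g)) + c f true := by
  have h1 := Finset.add_sum_erase Finset.univ (fun g => c g (Function.update x f true g))
    (Finset.mem_univ f)
  have h2 := Finset.add_sum_erase Finset.univ (fun g => c g (x g)) (Finset.mem_univ f)
  have h3 : ∑ g ∈ Finset.univ.erase f, c g (Function.update x f true g)
      = ∑ g ∈ Finset.univ.erase f, c g (x g) :=
    Finset.sum_congr rfl fun g hg => by
      rw [Function.update_of_ne (Finset.ne_of_mem_erase hg)]
  simp only [Function.update_self, hf, hc, zero_add] at h1 h2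
  rw [← h1, ← h2, h3, add_comm]

theorem dpPlacement_spec (L : F → ℕ) (w : F → ℝ) (l : List F) (hl : l.Nodup) (m : ℕ) :
    ∑ f, L f * (dpPlacement L w l m f).toNat ≤ m ∧
      ∑ f, w f * (dpPlacement L w l m f).toNat = dpValue L w l m := by
  induction l generalizing m with
  | nil => simp [dpPlacement, dpValue]
  | cons g l ih =>
    rw [List.nodup_cons] at hl
    unfold dpPlacement
    split_ifs with h
    · have hg := dpPlacement_eq_false L w l (m - L g) g hl.1
      have hih := ih hl.2 (m - L g)
      have e1 := sum_update_true (fun f b => L f * b.toNat) (by simp) _ g hg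
      have e2 := sum_update_true (fun f b => w f * (b.toNat : ℝ)) (by simp) _ g hg
      rw [e1, e2, h.1, hih.2]
      refine ⟨?_, by simp⟩
      have h2 := h.2
      have h3 := hih.1
      simp only [Bool.toNat_true, mul_one]
      omega
    · refine ⟨(ih hl.2 m).1, (ih hl.2 m).2.trans ?_⟩
      by_cases hm : m < L g
      · simp [dpValue, hm]
      · have hne : dpValue L w (g :: l) m ≠ dpValue L w l (m - L g) + w g :=
          fun he => h ⟨he, not_lt.1 hm⟩
        have hv : dpValue L w (g :: l) m
            = max (dpValue L w l m) (dpValue L w l (m - L g) + w g) := by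
          simp [dpValue, hm]
        rcases max_choice (dpValue L w l m) (dpValue L w l (m - L g) + w g) with h1 | h1
        · rw [hv, h1]
        · exact absurd (hv.trans h1) hne

theorem le_dpValue (L : F → ℕ) (w : F → ℝ) (l : List F) (m : ℕ) (y : F → Bool)
    (hy : ∀ f, y f = true → f ∈ l) (hm : ∑ f, L f * (y f).toNat ≤ m) :
    ∑ f, w f * (y f).toNat ≤ dpValue L w l m := by
  induction l generalizing m y with
  | nil =>
    have : ∀ f, y f = false := fun f => by
      by_contra h
      exact absurd (hy f (by simpa using h)) (by simp)
    simp [this, dpValue]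
  | cons g l ih =>
    cases hg : y g with
    | false =>
      have h1 := ih m y (fun f hf => by
        rcases List.mem_cons.1 (hy f hf) with h | h
        · rw [h, hg] at hf; cases hf
        · exact h) hm
      unfold dpValue
      split_ifs
      · exact h1
      · exact h1.trans (le_max_left _ _)
    | true =>
      set z := Function.update y g false with hz
      have hzg : z g = false := by simp [hz]
      have hzy : Function.update z g true = y := by
        rw [hz, Function.update_idem, ← hg, Function.update_eq_self]
      have e1 := sum_update_true (fun f b => L f * b.toNat) (by simp) z g hzg
      have e2 := sum_update_true (fun f b => w f * (b.toNat : ℝ)) (by simp) z g hzg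
      rw [hzy] at e1 e2
      simp only [Bool.toNat_true, mul_one, Nat.cast_one] at e1 e2
      have h1 := ih (m - L g) z (fun f hf => by
        by_cases hfg : f = g
        · rw [hfg, hzg] at hf; cases hf
        · rw [hz, Function.update_of_ne hfg] at hf
          rcases List.mem_cons.1 (hy f hf) with h | h
          · exact absurd h hfg
          · exact h) (by omega)
      have hlt : ¬ m < L g := by omega
      rw [e2]
      unfold dpValue
      rw [if_neg hlt]
      exact (add_le_add_left h1 _).trans (le_max_right _ _)

/-- The dynamic programming subroutine solves the one-slot problem. -/
theorem setCachePlacement_optimal (sys : System N U F) (order : Finset F → List F)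
    (horder : ∀ s, (order s).Nodup ∧ (order s).toFinset = s) (n : N) (w : F → ℝ) :
    IsOptimalPlacement sys n w (setCachePlacement sys order n w) := by
  obtain ⟨hnd, hset⟩ := horder (Finset.univ.filter fun f => 0 ≤ w f)
  have hspec := dpPlacement_spec sys.size w _ hnd (sys.cap n)
  refine ⟨hspec.1, fun y hy => ?_⟩
  have key := le_dpValue sys.size w (order (Finset.univ.filter fun f => 0 ≤ w f)) (sys.cap n)
    (fun f => y f && decide (0 ≤ w f))
    (fun f hf => by
      rw [← List.mem_toFinset, hset]
      simp only [Bool.and_eq_true, decide_eq_true_eq] at hf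
      simpa using hf.2)
    (le_trans (Finset.sum_le_sum fun f _ => Nat.mul_le_mul_left _ (by
      cases y f <;> simp [Bool.toNat_le])) hy)
  refine le_trans (Finset.sum_le_sum fun f _ => ?_) (key.trans hspec.2.ge)
  by_cases h : 0 ≤ w f
  · simp [h]
  · cases y f <;> simp [h, (not_le.1 h).le]

end Placement

/-! ### The scheme CPHBL -/

section Scheme

variable {N U F : Type*} [Fintype N] [Fintype U] [Fintype F] [DecidableEq N] [DecidableEq F]

/-- The variables that CPHBL maintains: `count n f` is the number `h_{n,f}` of past slots in which
`f` was cached on `n`, `total n f` is the sum of all offline and online demand observations of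
`f` on `n`, and `queue n` is the virtual queue of server `n`. -/
structure State (N F : Type*) where
  count : N → F → ℕ
  total : N → F → ℝ
  queue : N → ℝ

/-- The HUCB1 estimate of the popularity of file `f` on server `n` in slot `t`. -/
def estimate (sys : System N U F) (t : ℕ) (st : State N F) (n : N) (f : F) : ℝ :=
  if 0 < t ∧ 0 < st.count n f + sys.hist n f then
    min (st.total n f / ((st.count n f : ℝ) + sys.hist n f)
        + sys.numUsers n *
          Real.sqrt (3 * Real.log t / (2 * ((st.count n f : ℝ) + sys.hist n f))))
      (sys.numUsers n)
  else sys.numUsers n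

/-- The weight of caching file `f` on server `n` in slot `t`. -/
def weight (sys : System N U F) (V : ℝ) (t : ℕ) (st : State N F) (n : N) (f : F) : ℝ :=
  sys.size f * (V * estimate sys t st n f - sys.unitCost * st.queue n)

/-- The placement chosen by CPHBL in slot `t`; `solve` is the routine that solves the one-slot
problems. -/
def placement (sys : System N U F) (V : ℝ) (solve : ℕ → N → (F → ℝ) → F → Bool)
    (t : ℕ) (st : State N F) (n : N) : F → Bool :=
  solve t n (weight sys V t st n)

/-- The variables of CPHBL at the beginning of slot `t`, for given offline data `Dh` and
demands `D`. -/
def state (sys : System N U F) (V : ℝ) (solve : ℕ → N → (F → ℝ) → F → Bool)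
    (Dh : (n : N) → (f : F) → Fin (sys.hist n f) → ℕ) (D : ℕ → N → F → ℕ) : ℕ → State N F
  | 0 =>
    { count := fun _ _ => 0
      total := fun n f => ∑ s, (Dh n f s : ℝ)
      queue := fun _ => 0 }
  | t + 1 =>
    let st := state sys V solve Dh D t
    let x := placement sys V solve t st
    { count := fun n f => st.count n f + (x n f).toNat
      total := fun n f => st.total n f + (D t n f : ℝ) * (x n f).toNat
      queue := fun n => max (st.queue n - sys.budget n) 0 + sys.cost (x n) }

/-- The placements made by CPHBL. -/
def cphbl (sys : System N U F) (V : ℝ) (solve : ℕ → N → (F → ℝ) → F → Bool)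
    (Dh : (n : N) → (f : F) → Fin (sys.hist n f) → ℕ) (D : ℕ → N → F → ℕ)
    (t : ℕ) : N → F → Bool :=
  placement sys V solve t (state sys V solve Dh D t)

end Scheme

end FogCache

end

/-! The algorithm is compared with every vector `p` of caching frequencies in the closed convex hull
of the admissible placements, the cost constraint being priced by multipliers. The time-averaged
frequencies of a feasible scheme form such a vector, and causality makes the average reward linear
in them. Weak duality (`optReward_le`) then gives R* ≤ A as soon as reward(p) ≤ A + ∑ C_n (cost_n(p)
- b_n) holds for all `p` with some C_n ≥ 0. No optimal stationary policy is needed; C_n is the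
expected queue length averaged over the horizon and divided by V.

The inequality for `p` comes from drift plus penalty (`queue_sq_le`, `sum_estimate_mixed_le`): half
the squared queue grows in a slot by at most a constant plus Q_n (C_n(t) - b_n), and the chosen
placement maximizes a linear functional, hence does at least as well as `p`. This compares rewards
computed with the estimates. Passing to the true means costs the underestimation along `p` and the
overestimation of the files actually cached.

Both errors are read off one object, `SampledWalk`: the observed total demand minus its mean,
advanced only in slots where the file is cached. Its exponential supermartingale shows that a
popularity is underestimated by at most 3 K_n in total (`sum_integral_sub_estimate_le`). For cached
files, the overestimation is at most a confidence width plus |M|/m, with M the walk and m the number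
of observations. The widths are summed over the values of the counter. The terms |M|/m are
controlled in mean square through the potential M²/m (`sum_integral_sq_div_le`). Cauchy-Schwarz and
the capacity turn each of the two into the same square-root term, hence the factor 2 in Γ. Slot 0
adds K_n M_n, which raises the constant from 3 to 4 (`sum_integral_estimate_sub_le`). -/

set_option linter.unusedSectionVars false

/-! ### Predictably sampled walks: integrability and one-step estimates -/

/-- A sum of centred random variables with values in an interval of length `K` that is sampled
along predictable slots: the increment `ξ t` is added to the walk `M` iff `x t` holds, and `h t`
counts the increments added so far. The initial value `M 0` behaves like a sum of `H` independent
increments. -/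
structure SampledWalk {Ω : Type*} [MeasurableSpace Ω] (P : Measure Ω) (K : ℝ) (H : ℕ)
    (M : ℕ → Ω → ℝ) (h : ℕ → Ω → ℕ) (x : ℕ → Ω → Bool) (ξ : ℕ → Ω → ℝ) : Prop where
  bound_nonneg : 0 ≤ K
  measurable_walk : ∀ t, Measurable (M t)
  measurable_count : ∀ t, Measurable (h t)
  measurable_pick : ∀ t, Measurable (x t)
  measurable_noise : ∀ t, Measurable (ξ t)
  walk_succ : ∀ t ω, M (t + 1) ω = M t ω + (x t ω).toNat * ξ t ω
  count_zero : ∀ ω, h 0 ω = 0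
  count_succ : ∀ t ω, h (t + 1) ω = h t ω + (x t ω).toNat
  indep : ∀ t, IndepFun (fun ω => (M t ω, h t ω, x t ω)) (ξ t) P
  noise_abs_le : ∀ t ω, |ξ t ω| ≤ K
  noise_mean : ∀ t, ∫ ω, ξ t ω ∂P = 0
  noise_sq : ∀ t, ∫ ω, ξ t ω ^ 2 ∂P ≤ K ^ 2 / 4
  noise_mgf : ∀ t l, ∫ ω, Real.exp (l * ξ t ω) ∂P ≤ Real.exp (l ^ 2 * K ^ 2 / 8)
  init_bdd : ∃ C, ∀ᵐ ω ∂P, |M 0 ω| ≤ C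
  init_zero : H = 0 → ∀ ω, M 0 ω = 0
  init_sq : ∫ ω, M 0 ω ^ 2 ∂P ≤ H * (K ^ 2 / 4)
  init_mgf : ∀ l, ∫ ω, Real.exp (l * M 0 ω) ∂P ≤ Real.exp (l ^ 2 * K ^ 2 / 8 * H)

namespace SampledWalk

variable {Ω : Type*} [MeasurableSpace Ω] {P : Measure Ω} {K : ℝ} {H : ℕ}
  {M : ℕ → Ω → ℝ} {h : ℕ → Ω → ℕ} {x : ℕ → Ω → Bool} {ξ : ℕ → Ω → ℝ}

theorem count_le (S : SampledWalk P K H M h x ξ) (t : ℕ) (ω : Ω) : h t ω ≤ t := by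
  induction t with
  | zero => simp [S.count_zero]
  | succ t ih =>
    rw [S.count_succ]
    have := Bool.toNat_le (x t ω)
    omega

theorem walk_bdd (S : SampledWalk P K H M h x ξ) (t : ℕ) : ∃ C, ∀ᵐ ω ∂P, |M t ω| ≤ C := by
  induction t with
  | zero => exact S.init_bdd
  | succ t ih =>
    obtain ⟨C, hC⟩ := ih
    refine ⟨C + K, hC.mono fun ω hω => ?_⟩
    rw [S.walk_succ]
    refine (abs_add_le _ _).trans (add_le_add hω ?_)
    cases x t ω <;> simp [S.noise_abs_le t ω, S.bound_nonneg]

/-- Before any observation the walk vanishes, so quotients by `h + H = 0` never matter. -/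
theorem walk_eq_zero (S : SampledWalk P K H M h x ξ) (t : ℕ) (ω : Ω) (hm : h t ω + H = 0) :
    M t ω = 0 := by
  induction t with
  | zero => exact S.init_zero (by omega) ω
  | succ t ih =>
    rw [S.count_succ] at hm
    have h0 : (x t ω).toNat = 0 := by omega
    rw [S.walk_succ, ih (by omega), h0]; simp

theorem measurable_state_fun {F : ℝ → ℕ → Bool → ℝ} (hF : ∀ k b, Measurable fun y => F y k b) :
    Measurable fun q : ℝ × ℕ × Bool => F q.1 q.2.1 q.2.2 :=
  measurable_from_prod_countable_left fun kb => hF kb.1 kb.2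

theorem measurable_state (S : SampledWalk P K H M h x ξ) (t : ℕ) :
    Measurable fun ω => (M t ω, h t ω, x t ω) :=
  (S.measurable_walk t).prodMk ((S.measurable_count t).prodMk (S.measurable_pick t))

variable [IsProbabilityMeasure P]

/-- At a fixed time the walk is almost surely bounded and the counter and the pick take finitely
many values, so continuity in the walk variable alone suffices. -/
theorem integrable_comp (S : SampledWalk P K H M h x ξ) (t : ℕ) {F : ℝ → ℕ → Bool → ℝ}
    (hF : ∀ k b, Continuous fun y => F y k b) :
    Integrable (fun ω => F (M t ω) (h t ω) (x t ω)) P := by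
  obtain ⟨C, hC⟩ := S.walk_bdd t
  have hex : ∀ k b, ∃ c, ∀ y ∈ Set.Icc (-C) C, ‖F y k b‖ ≤ c := fun k b =>
    isCompact_Icc.exists_bound_of_continuousOn (hF k b).continuousOn
  choose c hc using hex
  refine Integrable.of_bound ((measurable_state_fun fun k b => (hF k b).measurable).comp
    (S.measurable_state t)).aestronglyMeasurable
    (∑ k ∈ Finset.range (t + 1), ∑ b, |c k b|) (hC.mono fun ω hω => ?_)
  refine (hc _ _ _ (abs_le.1 hω)).trans ((le_abs_self _).trans ?_)
  refine (Finset.single_le_sum (f := fun b => |c (h t ω) b|) (fun _ _ => abs_nonneg _)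
    (Finset.mem_univ (x t ω))).trans ?_
  exact Finset.single_le_sum (f := fun k => ∑ b, |c k b|)
    (fun _ _ => Finset.sum_nonneg fun _ _ => abs_nonneg _)
    (Finset.mem_range.2 (Nat.lt_succ_of_le (S.count_le t ω)))

theorem integrable_noise (S : SampledWalk P K H M h x ξ) (t : ℕ) {ψ : ℝ → ℝ}
    (hψ : Continuous ψ) : Integrable (fun ω => ψ (ξ t ω)) P := by
  obtain ⟨c, hc⟩ := (isCompact_Icc (a := -K) (b := K)).exists_bound_of_continuousOn hψ.continuousOn
  exact Integrable.of_bound (hψ.measurable.comp (S.measurable_noise t)).aestronglyMeasurable c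
    (Eventually.of_forall fun ω => hc _ (abs_le.1 (S.noise_abs_le t ω)))

/-- This is where predictability acts: the pick is made before the increment is seen, so
expectations factor. -/
theorem integral_mul_noise (S : SampledWalk P K H M h x ξ) (t : ℕ) {F : ℝ → ℕ → Bool → ℝ}
    (hF : ∀ k b, Continuous fun y => F y k b) {ψ : ℝ → ℝ} (hψ : Continuous ψ) :
    Integrable (fun ω => F (M t ω) (h t ω) (x t ω) * ψ (ξ t ω)) P ∧
    ∫ ω, F (M t ω) (h t ω) (x t ω) * ψ (ξ t ω) ∂P
      = (∫ ω, F (M t ω) (h t ω) (x t ω) ∂P) * ∫ ω, ψ (ξ t ω) ∂P := by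
  have hind := (S.indep t).comp (measurable_state_fun fun k b => (hF k b).measurable)
    hψ.measurable
  have h1 := S.integrable_comp t hF
  have h2 := S.integrable_noise t hψ
  exact ⟨hind.integrable_mul h1 h2,
    hind.integral_fun_mul_eq_mul_integral h1.aestronglyMeasurable h2.aestronglyMeasurable⟩

/-- The exponential supermartingale of a sampled walk. -/
theorem integral_exp_le_one (S : SampledWalk P K H M h x ξ) (l : ℝ) (t : ℕ) :
    ∫ ω, Real.exp (l * M t ω - l ^ 2 * K ^ 2 / 8 * (h t ω + H)) ∂P ≤ 1 := by
  induction t with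
  | zero =>
    have : ∀ ω, Real.exp (l * M 0 ω - l ^ 2 * K ^ 2 / 8 * (h 0 ω + H))
        = Real.exp (l * M 0 ω) * Real.exp (-(l ^ 2 * K ^ 2 / 8 * H)) := fun ω => by
      rw [S.count_zero, ← Real.exp_add]; congr 1; push_cast; ring
    simp_rw [this]
    rw [integral_mul_const]
    calc _ ≤ Real.exp (l ^ 2 * K ^ 2 / 8 * H) * Real.exp (-(l ^ 2 * K ^ 2 / 8 * H)) := by
          gcongr; exact S.init_mgf l
      _ = 1 := by rw [← Real.exp_add]; simp
  | succ t ih =>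
    set G : ℝ → ℕ → Bool → ℝ := fun y k b =>
      Real.exp (l * y - l ^ 2 * K ^ 2 / 8 * (k + H)) with hG
    have hGc : ∀ k b, Continuous fun y => G y k b := fun k b => by simp only [hG]; fun_prop
    -- `G0` lives on the unsampled slots, where nothing changes. `G1` lives on the sampled ones and
    -- carries the compensator that cancels the moment generating function of the increment.
    set G1 : ℝ → ℕ → Bool → ℝ := fun y k b => (b.toNat : ℝ) * Real.exp (-(l ^ 2 * K ^ 2 / 8)) *
      G y k b with hG1
    have hG1c : ∀ k b, Continuous fun y => G1 y k b := fun k b => by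
      simp only [hG1]; exact continuous_const.mul (hGc k b)
    set G0 : ℝ → ℕ → Bool → ℝ := fun y k b => (1 - (b.toNat : ℝ)) * G y k b with hG0
    have hG0c : ∀ k b, Continuous fun y => G0 y k b := fun k b => by
      simp only [hG0]; exact continuous_const.mul (hGc k b)
    have key : ∀ ω, Real.exp (l * M (t + 1) ω - l ^ 2 * K ^ 2 / 8 * (h (t + 1) ω + H))
        = G0 (M t ω) (h t ω) (x t ω) +
          G1 (M t ω) (h t ω) (x t ω) * Real.exp (l * ξ t ω) := fun ω => by
      rw [S.walk_succ, S.count_succ]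
      cases x t ω
      · simp [hG0, hG1, hG]
      · simp only [hG0, hG1, hG, Bool.toNat_true, Nat.cast_one, sub_self, zero_mul, zero_add,
          one_mul, ← Real.exp_add]
        congr 1; push_cast; ring
    simp_rw [key]
    obtain ⟨i1, e1⟩ := S.integral_mul_noise t hG1c (ψ := fun y => Real.exp (l * y)) (by fun_prop)
    have i0 := S.integrable_comp t hG0c
    rw [integral_add i0 i1, e1]
    have n1 : 0 ≤ ∫ ω, G1 (M t ω) (h t ω) (x t ω) ∂P :=
      integral_nonneg fun ω => by simp only [hG1, hG]; positivity
    calc _ ≤ (∫ ω, G0 (M t ω) (h t ω) (x t ω) ∂P) +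
          (∫ ω, G1 (M t ω) (h t ω) (x t ω) ∂P) * Real.exp (l ^ 2 * K ^ 2 / 8) := by
          gcongr; exact S.noise_mgf t l
      _ = ∫ ω, G (M t ω) (h t ω) (x t ω) ∂P := by
          rw [← integral_mul_const, ← integral_add i0 ((S.integrable_comp t hG1c).mul_const _)]
          refine integral_congr_ae (Eventually.of_forall fun ω => ?_)
          simp only [hG0, hG1]
          have : Real.exp (-(l ^ 2 * K ^ 2 / 8)) * Real.exp (l ^ 2 * K ^ 2 / 8) = 1 := by
            rw [← Real.exp_add]; simp
          linear_combination ((x t ω).toNat : ℝ) * G (M t ω) (h t ω) (x t ω) * this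
      _ ≤ 1 := ih

/-- One step of a weighted second moment of a sampled walk. -/
theorem integral_sq_succ_le (S : SampledWalk P K H M h x ξ) (g : ℕ → ℝ) (hg : ∀ k, 0 ≤ g k)
    (t : ℕ) :
    ∫ ω, M (t + 1) ω ^ 2 * g (h (t + 1) ω) ∂P
      ≤ (∫ ω, M t ω ^ 2 * g (h t ω + (x t ω).toNat) ∂P)
        + K ^ 2 / 4 * ∫ ω, ((x t ω).toNat : ℝ) * g (h t ω + 1) ∂P := by
  have c0 : ∀ (k : ℕ) (b : Bool), Continuous fun y : ℝ => y ^ 2 * g (k + b.toNat) := by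
    intro k b; fun_prop
  have c1 : ∀ (k : ℕ) (b : Bool), Continuous fun y : ℝ => 2 * y * (b.toNat : ℝ) * g (k + 1) := by
    intro k b; fun_prop
  have c2 : ∀ (k : ℕ) (b : Bool), Continuous fun _ : ℝ => (b.toNat : ℝ) * g (k + 1) := by
    intro k b; fun_prop
  -- The cross term will integrate to zero, because its coefficient is independent of the centred
  -- increment.
  have key : ∀ ω, M (t + 1) ω ^ 2 * g (h (t + 1) ω) = M t ω ^ 2 * g (h t ω + (x t ω).toNat)
      + (2 * M t ω * ((x t ω).toNat : ℝ) * g (h t ω + 1) * ξ t ω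
      + ((x t ω).toNat : ℝ) * g (h t ω + 1) * ξ t ω ^ 2) := fun ω => by
    rw [S.walk_succ, S.count_succ]
    cases x t ω
    · simp
    · simp; ring
  simp_rw [key]
  obtain ⟨i1, e1⟩ := S.integral_mul_noise t c1 (ψ := fun y => y) (by fun_prop)
  obtain ⟨i2, e2⟩ := S.integral_mul_noise t c2 (ψ := fun y => y ^ 2) (by fun_prop)
  have i0 := S.integrable_comp t c0
  have n2 : 0 ≤ ∫ ω, ((x t ω).toNat : ℝ) * g (h t ω + 1) ∂P :=
    integral_nonneg fun ω => mul_nonneg (by positivity) (hg _)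
  have i12 : Integrable (fun ω => 2 * M t ω * ((x t ω).toNat : ℝ) * g (h t ω + 1) * ξ t ω
      + ((x t ω).toNat : ℝ) * g (h t ω + 1) * ξ t ω ^ 2) P := i1.add i2
  rw [integral_add i0 i12, integral_add i1 i2, e1, e2, S.noise_mean, mul_zero, zero_add,
    mul_comm (K ^ 2 / 4)]
  gcongr
  exact S.noise_sq t

end SampledWalk

/-! ### Squared errors and lower deviations of sampled means -/

namespace SampledWalk

variable {Ω : Type*} [MeasurableSpace Ω] {P : Measure Ω} {K : ℝ} {H : ℕ}
  {M : ℕ → Ω → ℝ} {h : ℕ → Ω → ℕ} {x : ℕ → Ω → Bool} {ξ : ℕ → Ω → ℝ}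

/-- Summing over the sampled slots is summing over the values of the counter. -/
theorem sum_pick_mul (S : SampledWalk P K H M h x ξ) (φ : ℕ → ℝ) (T : ℕ) (ω : Ω) :
    ∑ t ∈ Finset.range T, ((x t ω).toNat : ℝ) * φ (h t ω) = ∑ j ∈ Finset.range (h T ω), φ j := by
  induction T with
  | zero => simp [S.count_zero]
  | succ T ih =>
    rw [Finset.sum_range_succ, ih, S.count_succ]
    cases x T ω
    · simp
    · simp [Finset.sum_range_succ]

variable [IsProbabilityMeasure P]

theorem integral_sq_le (S : SampledWalk P K H M h x ξ) (t : ℕ) :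
    ∫ ω, M t ω ^ 2 ∂P ≤ (H + t) * (K ^ 2 / 4) := by
  induction t with
  | zero => simpa using S.init_sq
  | succ t ih =>
    have h1 := S.integral_sq_succ_le (fun _ => 1) (fun _ => zero_le_one) t
    simp only [mul_one] at h1
    have h2 : ∫ ω, ((x t ω).toNat : ℝ) ∂P ≤ 1 := by
      have := integral_mono (S.integrable_comp t (F := fun _ _ b => (b.toNat : ℝ))
        (fun _ _ => continuous_const)) (integrable_const (μ := P) (1 : ℝ))
        (fun ω => by cases x t ω <;> simp)
      simpa using this
    push_cast
    nlinarith [sq_nonneg K]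

theorem integrable_pick_mul_sq_div (S : SampledWalk P K H M h x ξ) (t : ℕ) :
    Integrable (fun ω => ((x t ω).toNat : ℝ) * (M t ω ^ 2 / ((h t ω : ℝ) + H) ^ 2)) P :=
  S.integrable_comp t (F := fun y k b => (b.toNat : ℝ) * (y ^ 2 / ((k : ℝ) + H) ^ 2))
    (fun k b => by fun_prop)

/-- Offline data dominate here: the denominator is at least H², while the second moment of the walk
stays below H K² / 2. -/
theorem sum_integral_sq_div_le_of_lt (S : SampledWalk P K H M h x ξ) (T : ℕ) (hT : T < H) :
    ∑ t ∈ Finset.range T, ∫ ω, ((x t ω).toNat : ℝ) * (M t ω ^ 2 / ((h t ω : ℝ) + H) ^ 2) ∂P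
      ≤ T * (K ^ 2 / (2 * H)) := by
  have hH : (0 : ℝ) < H := by exact_mod_cast (by omega : 0 < H)
  have : ∀ t ∈ Finset.range T,
      ∫ ω, ((x t ω).toNat : ℝ) * (M t ω ^ 2 / ((h t ω : ℝ) + H) ^ 2) ∂P ≤ K ^ 2 / (2 * H) := by
    intro t ht
    have htH : (t : ℝ) ≤ H := by
      exact_mod_cast ((Finset.mem_range.1 ht).trans hT).le
    calc _ ≤ ∫ ω, M t ω ^ 2 / (H : ℝ) ^ 2 ∂P := by
          refine integral_mono (S.integrable_pick_mul_sq_div t)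
            (S.integrable_comp t (F := fun y _ _ => y ^ 2 / (H : ℝ) ^ 2)
              (fun k b => by fun_prop)) (fun ω => ?_)
          have h1 : M t ω ^ 2 / ((h t ω : ℝ) + H) ^ 2 ≤ M t ω ^ 2 / (H : ℝ) ^ 2 := by
            gcongr; simp
          have h2 : 0 ≤ M t ω ^ 2 / (H : ℝ) ^ 2 := by positivity
          dsimp only
          cases x t ω
          · simpa using h2
          · simpa using h1
      _ ≤ (H + t) * (K ^ 2 / 4) / (H : ℝ) ^ 2 := by
          rw [integral_div]; gcongr; exact S.integral_sq_le t
      _ ≤ (H + H) * (K ^ 2 / 4) / (H : ℝ) ^ 2 := by gcongr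
      _ = K ^ 2 / (2 * H) := by field_simp; ring
  simpa using Finset.sum_le_sum this

/-- Potential argument for M²/m with m = h + H. A sample raises m by one and lowers the potential by
at least M²/(2m²), while its noise adds at most K²/4 times 1/(m+1). The decreases telescope and the
noise terms form a harmonic sum. -/
theorem sum_integral_sq_div_le_log (S : SampledWalk P K H M h x ξ) (T : ℕ) :
    ∑ t ∈ Finset.range T, ∫ ω, ((x t ω).toNat : ℝ) * (M t ω ^ 2 / ((h t ω : ℝ) + H) ^ 2) ∂P
      ≤ K ^ 2 / 2 * (2 + Real.log T) := by
  have step : ∀ t, (1 / 2) * ∫ ω, ((x t ω).toNat : ℝ) * (M t ω ^ 2 / ((h t ω : ℝ) + H) ^ 2) ∂P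
      ≤ (∫ ω, M t ω ^ 2 * (1 / ((h t ω : ℝ) + H)) ∂P)
        - (∫ ω, M (t + 1) ω ^ 2 * (1 / ((h (t + 1) ω : ℝ) + H)) ∂P)
        + K ^ 2 / 4 * ∫ ω, ((x t ω).toNat : ℝ) * (1 / ((h t ω : ℝ) + 1)) ∂P := by
    intro t
    have h1 := S.integral_sq_succ_le (fun k => 1 / ((k : ℝ) + H)) (fun k => by positivity) t
    simp only [Nat.cast_add, Nat.cast_one] at h1
    -- Dropping H from the denominator leaves a sum over the counter that is harmonic whatever H is.
    have h2 : ∫ ω, ((x t ω).toNat : ℝ) * (1 / ((h t ω : ℝ) + 1 + H)) ∂P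
        ≤ ∫ ω, ((x t ω).toNat : ℝ) * (1 / ((h t ω : ℝ) + 1)) ∂P := by
      refine integral_mono
        (S.integrable_comp t (F := fun _ k b => (b.toNat : ℝ) * (1 / ((k : ℝ) + 1 + H)))
          (fun k b => continuous_const))
        (S.integrable_comp t (F := fun _ k b => (b.toNat : ℝ) * (1 / ((k : ℝ) + 1)))
          (fun k b => continuous_const)) (fun ω => ?_)
      refine mul_le_mul_of_nonneg_left (one_div_le_one_div_of_le (by positivity) ?_) (by positivity)
      simp
    have h3 : ∫ ω, M t ω ^ 2 * (1 / ((h t ω : ℝ) + ((x t ω).toNat : ℝ) + H)) ∂P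
        ≤ (∫ ω, M t ω ^ 2 * (1 / ((h t ω : ℝ) + H)) ∂P)
          - (1 / 2) * ∫ ω, ((x t ω).toNat : ℝ) * (M t ω ^ 2 / ((h t ω : ℝ) + H) ^ 2) ∂P := by
      have ia := S.integrable_comp t (F := fun y k _ => y ^ 2 * (1 / ((k : ℝ) + H)))
        (fun k b => by fun_prop)
      rw [← integral_const_mul, ← integral_sub ia ((S.integrable_pick_mul_sq_div t).const_mul _)]
      refine integral_mono
        (S.integrable_comp t (F := fun y k b => y ^ 2 * (1 / ((k : ℝ) + (b.toNat : ℝ) + H)))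
          (fun k b => by fun_prop))
        (ia.sub ((S.integrable_pick_mul_sq_div t).const_mul _)) (fun ω => ?_)
      dsimp only
      -- With no observations the walk is zero and so are all terms. Otherwise m ≥ 1, which is what
      -- 1/(m+1) ≤ 1/m - 1/(2m²) requires.
      rcases Nat.eq_zero_or_pos (h t ω + H) with hm | hm
      · simp [S.walk_eq_zero t ω hm]
      · have hm' : (1 : ℝ) ≤ (h t ω : ℝ) + H := by exact_mod_cast hm
        set m := (h t ω : ℝ) + H
        cases x t ω
        · simp [m]
        · have e : (h t ω : ℝ) + ((true.toNat : ℕ) : ℝ) + H = m + 1 := by simp [m]; ring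
          rw [e]
          simp only [Bool.toNat_true, Nat.cast_one, one_mul]
          have : 1 / (m + 1) ≤ 1 / m - 1 / 2 * (1 / m ^ 2) := by
            have : 1 / m - 1 / 2 * (1 / m ^ 2) - 1 / (m + 1) = (m - 1) / (2 * m ^ 2 * (m + 1)) := by
              field_simp; ring
            have : 0 ≤ (m - 1) / (2 * m ^ 2 * (m + 1)) :=
              div_nonneg (by linarith) (by positivity)
            linarith
          calc _ ≤ M t ω ^ 2 * (1 / m - 1 / 2 * (1 / m ^ 2)) := by gcongr
            _ = _ := by ring
    have hK : 0 ≤ K ^ 2 / 4 := by positivity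
    nlinarith [mul_le_mul_of_nonneg_left h2 hK]
  have htel := Finset.sum_le_sum fun t (_ : t ∈ Finset.range T) => step t
  rw [← Finset.mul_sum, Finset.sum_add_distrib, Finset.sum_range_sub', ← Finset.mul_sum,
    ← integral_finsetSum _ fun t _ => S.integrable_comp t
      (F := fun _ k b => (b.toNat : ℝ) * (1 / ((k : ℝ) + 1))) (fun k b => continuous_const)] at htel
  have h0 : ∫ ω, M 0 ω ^ 2 * (1 / ((h 0 ω : ℝ) + H)) ∂P ≤ K ^ 2 / 4 := by
    rcases Nat.eq_zero_or_pos H with hH | hH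
    · simp only [S.init_zero hH]; simp; positivity
    · have hH' : (0 : ℝ) < H := by exact_mod_cast hH
      simp only [S.count_zero, Nat.cast_zero, zero_add]
      rw [integral_mul_const]
      calc _ ≤ H * (K ^ 2 / 4) * (1 / (H : ℝ)) := by gcongr; exact S.init_sq
        _ = K ^ 2 / 4 := by field_simp
  have hT0 : 0 ≤ ∫ ω, M T ω ^ 2 * (1 / ((h T ω : ℝ) + H)) ∂P :=
    integral_nonneg fun ω => by positivity
  have hs : ∫ ω, ∑ t ∈ Finset.range T, ((x t ω).toNat : ℝ) * (1 / ((h t ω : ℝ) + 1)) ∂P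
      ≤ 1 + Real.log T := by
    have hb : ∀ ω, ∑ t ∈ Finset.range T, ((x t ω).toNat : ℝ) * (1 / ((h t ω : ℝ) + 1))
        ≤ 1 + Real.log T := fun ω => by
      rw [S.sum_pick_mul (fun k => 1 / ((k : ℝ) + 1))]
      calc _ ≤ ∑ j ∈ Finset.range T, 1 / ((j : ℝ) + 1) :=
            Finset.sum_le_sum_of_subset_of_nonneg
              (Finset.range_mono (S.count_le T ω)) fun _ _ _ => by positivity
        _ = ((harmonic T : ℚ) : ℝ) := by simp [harmonic]
        _ ≤ _ := harmonic_le_one_add_log T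
    have := integral_mono (integrable_finsetSum _ fun t _ => S.integrable_comp t
      (F := fun _ k b => (b.toNat : ℝ) * (1 / ((k : ℝ) + 1))) (fun k b => continuous_const))
      (integrable_const (μ := P) (1 + Real.log T)) hb
    simpa using this
  have hK : 0 ≤ K ^ 2 / 4 := by positivity
  nlinarith [mul_le_mul_of_nonneg_left hs hK]

/-- Total squared error of the sampled means, over the slots in which a sample is taken. -/
theorem sum_integral_sq_div_le (S : SampledWalk P K H M h x ξ) (T : ℕ) (hT : 2 ≤ T) :
    ∑ t ∈ Finset.range T, ∫ ω, ((x t ω).toNat : ℝ) * (M t ω ^ 2 / ((h t ω : ℝ) + H) ^ 2) ∂P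
      ≤ 6 * K ^ 2 * Real.log T * (T / ((T : ℝ) + H)) := by
  have hT' : (2 : ℝ) ≤ T := by exact_mod_cast hT
  have hlog : 0.69 ≤ Real.log T := by
    have := Real.log_le_log (by norm_num) hT'
    linarith [Real.log_two_gt_d9]
  -- If T < H, then T + H ≤ 2H and 1 ≤ 6 log T. If H ≤ T, then T/(T+H) ≥ 1/2 and 2 + log T ≤ 6 log
  -- T.
  rcases lt_or_ge T H with hH | hH
  · refine (S.sum_integral_sq_div_le_of_lt T hH).trans ?_
    have hH' : (T : ℝ) ≤ H := by exact_mod_cast hH.le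
    have h1 : (1 : ℝ) / (2 * H) ≤ 1 / (T + H) := one_div_le_one_div_of_le (by linarith) (by linarith)
    calc (T : ℝ) * (K ^ 2 / (2 * H)) = K ^ 2 * (T * (1 / (2 * H))) := by ring
      _ ≤ K ^ 2 * (T * (1 / (T + H))) := by gcongr
      _ ≤ (6 * Real.log T) * (K ^ 2 * (T * (1 / (T + H)))) :=
          le_mul_of_one_le_left (by positivity) (by linarith)
      _ = _ := by ring
  · refine (S.sum_integral_sq_div_le_log T).trans ?_
    have hH' : (H : ℝ) ≤ T := by exact_mod_cast hH
    have h1 : (1 : ℝ) / 2 ≤ T / (T + H) := by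
      rw [div_le_div_iff₀ (by norm_num) (by positivity)]; linarith
    calc K ^ 2 / 2 * (2 + Real.log T) ≤ K ^ 2 / 2 * (6 * Real.log T) := by gcongr; linarith
      _ = 6 * K ^ 2 * Real.log T * (1 / 2) := by ring
      _ ≤ _ := by gcongr

/-- A quantity that is positive only if the sampled mean falls below its confidence interval has
small expectation. -/
theorem integral_le_of_pos_imp (S : SampledWalk P K H M h x ξ) (t : ℕ) (ht : 1 ≤ t) {e : Ω → ℝ}
    (hint : Integrable e P) (hle : ∀ ω, e ω ≤ K)
    (hpos : ∀ ω, 0 < e ω → 0 < h t ω + H ∧ M t ω ≤ -(((h t ω : ℝ) + H) *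
      (K * Real.sqrt (3 * Real.log t / (2 * ((h t ω : ℝ) + H)))))) :
    ∫ ω, e ω ∂P ≤ 2 * K / (t : ℝ) ^ 2 := by
  have ht' : (1 : ℝ) ≤ t := by exact_mod_cast ht
  -- With m = j + H and r the square root, M = -mKr gives the exponent l M - l²K²m/8, which is
  -- maximal in l at l = -4r/K. Its value there is 4r²m - 2r²m = 3 log t, so `E j` is at least t³ on
  -- the deviation event with counter j.
  set l : ℕ → ℝ := fun j => -(4 * Real.sqrt (3 * Real.log t / (2 * ((j : ℝ) + H))) / K) with hl
  set E : ℕ → Ω → ℝ := fun j ω =>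
    Real.exp (l j * M t ω - l j ^ 2 * K ^ 2 / 8 * ((h t ω : ℝ) + H)) with hE
  have hEi : ∀ j, Integrable (E j) P := fun j =>
    S.integrable_comp t (F := fun y k _ =>
      Real.exp (l j * y - l j ^ 2 * K ^ 2 / 8 * ((k : ℝ) + H))) (fun k b => by fun_prop)
  -- The counter is random, so `E j` is summed over its t + 1 possible values. This union bound
  -- costs one power of t and leaves 1/t², which is summable.
  have hpt : ∀ ω, e ω ≤ K / (t : ℝ) ^ 3 * ∑ j ∈ Finset.range (t + 1), E j ω := fun ω => by
    have hK := S.bound_nonneg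
    rcases le_or_gt (e ω) 0 with he | he
    · exact he.trans (mul_nonneg (by positivity)
        (Finset.sum_nonneg fun j _ => (Real.exp_pos _).le))
    · have hKpos : 0 < K := he.trans_le (hle ω)
      obtain ⟨hm, hM⟩ := hpos ω he
      have hm' : (0 : ℝ) < (h t ω : ℝ) + H := by exact_mod_cast hm
      have hsum : (t : ℝ) ^ 3 ≤ ∑ j ∈ Finset.range (t + 1), E j ω := by
        refine le_trans ?_ (Finset.single_le_sum (f := fun j => E j ω)
          (fun j _ => (Real.exp_pos _).le)
          (Finset.mem_range.2 (Nat.lt_succ_of_le (S.count_le t ω))))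
        have : (t : ℝ) ^ 3 = Real.exp (3 * Real.log t) := by
          rw [mul_comm, Real.exp_mul, Real.exp_log (by linarith)]; norm_cast
        rw [this]
        refine Real.exp_le_exp.2 ?_
        set m := (h t ω : ℝ) + H
        have hs : 0 ≤ 3 * Real.log t / (2 * m) :=
          div_nonneg (by have := Real.log_nonneg ht'; linarith) (by positivity)
        set r := Real.sqrt (3 * Real.log t / (2 * m)) with hr
        have hr0 : 0 ≤ r := Real.sqrt_nonneg _
        have hr2 : r ^ 2 * m = 3 * Real.log t / 2 := by
          rw [hr, Real.sq_sqrt hs]; field_simp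
        have hlj : l (h t ω) = -(4 * r / K) := rfl
        rw [hlj]
        have e1 : (-(4 * r / K)) ^ 2 * K ^ 2 / 8 * m = 2 * (r ^ 2 * m) := by field_simp; ring
        have e2 : (4 * r / K) * (m * (K * r)) = 4 * (r ^ 2 * m) := by field_simp
        have e3 : (4 * r / K) * (m * (K * r)) ≤ -(4 * r / K) * M t ω := by
          have : (4 * r / K) * (m * (K * r)) ≤ (4 * r / K) * (-M t ω) := by
            gcongr; linarith
          linarith
        rw [e1]
        linarith
      calc e ω ≤ K := hle ω
        _ = K / (t : ℝ) ^ 3 * (t : ℝ) ^ 3 := by field_simp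
        _ ≤ _ := by gcongr
  have hK := S.bound_nonneg
  calc ∫ ω, e ω ∂P ≤ ∫ ω, K / (t : ℝ) ^ 3 * ∑ j ∈ Finset.range (t + 1), E j ω ∂P :=
        integral_mono hint ((integrable_finsetSum _ fun j _ => hEi j).const_mul _) hpt
    _ = K / (t : ℝ) ^ 3 * ∑ j ∈ Finset.range (t + 1), ∫ ω, E j ω ∂P := by
        rw [integral_const_mul, integral_finsetSum _ fun j _ => hEi j]
    _ ≤ K / (t : ℝ) ^ 3 * ∑ j ∈ Finset.range (t + 1), 1 := by
        gcongr with j _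
        exact S.integral_exp_le_one (l j) t
    _ = K / (t : ℝ) ^ 3 * ((t : ℝ) + 1) := by simp
    _ ≤ K / (t : ℝ) ^ 3 * (2 * t) := by gcongr; linarith
    _ = 2 * K / (t : ℝ) ^ 2 := by field_simp

end SampledWalk

/-! ### Deterministic inequalities, and a lemma on independence -/

/-- The width of a confidence interval after `m` observations, up to a factor; without
observations it is `1`. -/
noncomputable def confidenceWidth (m : ℕ) : ℝ := if m = 0 then 1 else 1 / Real.sqrt m

theorem confidenceWidth_nonneg (m : ℕ) : 0 ≤ confidenceWidth m := by
  unfold confidenceWidth; split_ifs <;> positivity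

/-- The range starts at two terms so that the default width at 0 is paired with the width at 1,
giving equality in the base case. The step is 1/√m ≤ 2(√m - √(m-1)). -/
theorem sum_confidenceWidth_range_add_two_le (h : ℕ) :
    ∑ j ∈ Finset.range (h + 2), confidenceWidth j ≤ 2 * Real.sqrt ((h : ℝ) + 1) := by
  induction h with
  | zero => norm_num [confidenceWidth, Finset.sum_range_succ]
  | succ h ih =>
    rw [Finset.sum_range_succ]
    have hw : confidenceWidth (h + 2) = 1 / Real.sqrt ((h : ℝ) + 2) := by
      simp [confidenceWidth]
    have e : ((h + 1 : ℕ) : ℝ) + 1 = (h : ℝ) + 2 := by push_cast; ring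
    rw [hw, e]
    have ha : 0 < Real.sqrt ((h : ℝ) + 2) := Real.sqrt_pos.2 (by positivity)
    have ha2 := Real.sq_sqrt (show (0 : ℝ) ≤ (h : ℝ) + 2 by positivity)
    have hb2 := Real.sq_sqrt (show (0 : ℝ) ≤ (h : ℝ) + 1 by positivity)
    set a := Real.sqrt ((h : ℝ) + 2)
    set b := Real.sqrt ((h : ℝ) + 1)
    have : 1 / a ≤ 2 * a - 2 * b := by
      rw [div_le_iff₀ ha]; nlinarith [sq_nonneg (a - b)]
    linarith

/-- The form h/√(h+H) is the one that the Cauchy-Schwarz bound over files in `sum_mul_div_sqrt_le`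
accepts. -/
theorem sum_confidenceWidth_le (H h : ℕ) :
    ∑ j ∈ Finset.range h, confidenceWidth (j + H) ≤ 2 * (h / Real.sqrt ((h : ℝ) + H)) := by
  rcases Nat.eq_zero_or_pos H with rfl | hH
  · simp only [add_zero, Nat.cast_zero, Real.div_sqrt]
    match h with
    | 0 => simp
    | 1 => norm_num [confidenceWidth]
    | h + 2 =>
      refine (sum_confidenceWidth_range_add_two_le h).trans ?_
      gcongr
      push_cast; linarith
  · induction h with
    | zero => simp
    | succ h ih =>
      rw [Finset.sum_range_succ]
      refine (add_le_add_left ih _).trans ?_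
      have hw : confidenceWidth (h + H) = 1 / Real.sqrt ((h : ℝ) + H) := by
        rw [confidenceWidth, if_neg (by omega)]; push_cast; rfl
      have hH' : (1 : ℝ) ≤ H := by exact_mod_cast hH
      have h0 : (0 : ℝ) ≤ h := by positivity
      have ha : 0 < Real.sqrt ((h : ℝ) + H) := Real.sqrt_pos.2 (by positivity)
      have e : ((h + 1 : ℕ) : ℝ) + H = (h : ℝ) + H + 1 := by push_cast; ring
      have hb : 0 < Real.sqrt ((h : ℝ) + H + 1) := Real.sqrt_pos.2 (by positivity)
      have ha2 := Real.sq_sqrt (show (0 : ℝ) ≤ (h : ℝ) + H by positivity)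
      have hb2 := Real.sq_sqrt (show (0 : ℝ) ≤ (h : ℝ) + H + 1 by positivity)
      rw [hw, e]
      set a := Real.sqrt ((h : ℝ) + H)
      set b := Real.sqrt ((h : ℝ) + H + 1)
      -- After squaring, the difference of the two sides is 4hH - h + 3H - 1, nonnegative since H ≥
      -- 1.
      have key : (2 * (h : ℝ) + 1) * b ≤ 2 * ((h : ℝ) + 1) * a := by
        refine (pow_le_pow_iff_left₀ (by positivity) (by positivity) two_ne_zero).1 ?_
        rw [mul_pow, mul_pow, ha2, hb2]
        nlinarith [mul_nonneg h0 (sub_nonneg.2 hH')]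
      have : 2 * ((h : ℝ) / a) + 1 / a = (2 * h + 1) / a := by ring
      rw [this]
      have : 2 * (((h + 1 : ℕ) : ℝ) / b) = 2 * ((h : ℝ) + 1) / b := by push_cast; ring
      rw [this, div_le_div_iff₀ ha hb]
      exact key

/-- Cauchy-Schwarz with weights √L leaves ∑ L h²/(h+H). One factor h/(h+H) is at most T/(T+H₀), and
the remaining ∑ L h is the capacity used. -/
theorem sum_mul_div_sqrt_le {F : Type*} [Fintype F] (L : F → ℝ) (hL : ∀ f, 0 ≤ L f)
    (h H : F → ℝ) (T m H₀ : ℝ) (hh : ∀ f, 0 ≤ h f) (hhT : ∀ f, h f ≤ T) (hT : 0 < T)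
    (hH₀ : 0 ≤ H₀) (hH : ∀ f, H₀ ≤ H f) (hsum : ∑ f, L f * h f ≤ m * T) :
    ∑ f, L f * (h f / Real.sqrt (h f + H f)) ≤ T * Real.sqrt (m * (∑ f, L f) / (T + H₀)) := by
  have hcs := Real.sum_mul_le_sqrt_mul_sqrt Finset.univ (fun f => Real.sqrt (L f))
    (fun f => Real.sqrt (L f) * (h f / Real.sqrt (h f + H f)))
  have e1 : ∀ f, Real.sqrt (L f) * (Real.sqrt (L f) * (h f / Real.sqrt (h f + H f)))
      = L f * (h f / Real.sqrt (h f + H f)) := fun f => by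
    rw [← mul_assoc, Real.mul_self_sqrt (hL f)]
  have e2 : ∀ f, (Real.sqrt (L f) * (h f / Real.sqrt (h f + H f))) ^ 2
      = L f * (h f ^ 2 / (h f + H f)) := fun f => by
    rw [mul_pow, div_pow, Real.sq_sqrt (hL f), Real.sq_sqrt (add_nonneg (hh f) (hH₀.trans (hH f)))]
  simp only [e1, e2, Real.sq_sqrt (hL _)] at hcs
  refine hcs.trans ?_
  have hb : ∑ f, L f * (h f ^ 2 / (h f + H f)) ≤ m * T * (T / (T + H₀)) := by
    calc _ ≤ ∑ f, L f * (h f * (T / (T + H₀))) := by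
          refine Finset.sum_le_sum fun f _ => mul_le_mul_of_nonneg_left ?_ (hL f)
          rcases (hh f).eq_or_lt with h0 | h0
          · simp [← h0]
          · have hHf : 0 ≤ H f := hH₀.trans (hH f)
            rw [← mul_div_assoc, div_le_div_iff₀ (by linarith) (by linarith)]
            nlinarith [mul_nonneg h0.le (mul_nonneg (hh f) (sub_nonneg.2 (hH f))), hH f, hhT f,
              mul_nonneg (mul_nonneg (sub_nonneg.2 (hhT f)) h0.le) hH₀,
              mul_nonneg (mul_nonneg hT.le h0.le) (sub_nonneg.2 (hH f))]
      _ = (∑ f, L f * h f) * (T / (T + H₀)) := by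
          rw [Finset.sum_mul]; exact Finset.sum_congr rfl fun f _ => by ring
      _ ≤ _ := by gcongr
  have hS : 0 ≤ ∑ f, L f := Finset.sum_nonneg fun f _ => hL f
  calc _ ≤ Real.sqrt (∑ f, L f) * Real.sqrt (m * T * (T / (T + H₀))) := by gcongr
    _ = Real.sqrt (T ^ 2 * (m * (∑ f, L f) / (T + H₀))) := by
        rw [← Real.sqrt_mul hS]; congr 1; ring
    _ = _ := by rw [Real.sqrt_mul (by positivity), Real.sqrt_sq hT.le]

/-- Cauchy-Schwarz in arithmetic-geometric form: the hypothesis makes the quadratic A c² - 2y c + B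
nonnegative, so its discriminant is not positive. The hypothesis can be checked termwise under
nested sums and integrals. -/
theorem le_sqrt_mul_of_forall_le {y A B : ℝ} (hA : 0 ≤ A) (hB : 0 ≤ B)
    (hy : ∀ c : ℝ, 0 < c → 2 * y ≤ c * A + B / c) : y ≤ Real.sqrt (A * B) := by
  rcases le_or_gt y 0 with h | h
  · exact h.trans (Real.sqrt_nonneg _)
  · refine Real.le_sqrt_of_sq_le ?_
    have := discrim_le_zero (a := A) (b := -(2 * y)) (c := B) fun c => by
      rcases le_or_gt c 0 with hc | hc
      · nlinarith [mul_nonneg hA (mul_self_nonneg c), mul_nonneg (neg_nonneg.2 hc) h.le]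
      · have h1 := mul_le_mul_of_nonneg_left (hy c hc) hc.le
        have h2 : c * (c * A + B / c) = A * (c * c) + B := by field_simp
        linarith
    rw [discrim] at this
    linarith

/-- Both hypotheses say that the joint law is a product, and products of measures are associative.
-/
theorem indepFun_prodMk_of_indepFun {Ω α β γ : Type*} [MeasurableSpace Ω] [MeasurableSpace α]
    [MeasurableSpace β] [MeasurableSpace γ] {P : Measure Ω} [IsProbabilityMeasure P]
    {A : Ω → α} {B : Ω → β} {C : Ω → γ} (hA : Measurable A) (hB : Measurable B)
    (hC : Measurable C) (h₁ : IndepFun A (fun ω => (B ω, C ω)) P) (h₂ : IndepFun B C P) :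
    IndepFun (fun ω => (A ω, B ω)) C P := by
  have h₃ : IndepFun A B P := h₁.comp measurable_id measurable_fst
  rw [indepFun_iff_map_prod_eq_prod_map_map hA.aemeasurable (hB.prodMk hC).aemeasurable] at h₁
  rw [indepFun_iff_map_prod_eq_prod_map_map hB.aemeasurable hC.aemeasurable] at h₂
  rw [indepFun_iff_map_prod_eq_prod_map_map hA.aemeasurable hB.aemeasurable] at h₃
  rw [indepFun_iff_map_prod_eq_prod_map_map (hA.prodMk hB).aemeasurable hC.aemeasurable]
  have := Measure.isProbabilityMeasure_map (μ := P) hA.aemeasurable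
  have := Measure.isProbabilityMeasure_map (μ := P) hB.aemeasurable
  have := Measure.isProbabilityMeasure_map (μ := P) hC.aemeasurable
  have e : (fun ω => ((A ω, B ω), C ω))
      = MeasurableEquiv.prodAssoc.symm ∘ fun ω => (A ω, (B ω, C ω)) := rfl
  rw [e, ← Measure.map_map MeasurableEquiv.prodAssoc.symm.measurable (hA.prodMk (hB.prodMk hC)),
    h₁, h₂, h₃]
  exact ((MeasurableEquiv.map_apply_eq_iff_map_symm_apply_eq _).1 Measure.prodAssoc_prod).symm

/-! ### The run of the algorithm and its demand deviations as sampled walks -/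

noncomputable section

namespace FogCache

variable {N U F : Type*} [Fintype N] [Fintype U] [Fintype F] [DecidableEq N] [DecidableEq F]

theorem demand_le_numUsers (sys : System N U F) (req : U → F → Bool) (n : N) (f : F) :
    sys.demand req n f ≤ sys.numUsers n := by
  unfold System.demand System.numUsers
  calc _ ≤ ∑ k ∈ Finset.univ.filter (fun k => sys.serve k = n), 1 :=
        Finset.sum_le_sum fun k _ => Bool.toNat_le _
    _ = _ := by simp

theorem state_congr (sys : System N U F) (V : ℝ) (solve : ℕ → N → (F → ℝ) → F → Bool)
    (Dh : (n : N) → (f : F) → Fin (sys.hist n f) → ℕ) (D D' : ℕ → N → F → ℕ) (t : ℕ)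
    (hD : ∀ s < t, D s = D' s) : state sys V solve Dh D t = state sys V solve Dh D' t := by
  induction t with
  | zero => rfl
  | succ t ih =>
    have := ih fun s hs => hD s (hs.trans (Nat.lt_succ_self t))
    simp only [state, this, hD t (Nat.lt_succ_self t)]

/-- The variables of CPHBL at the beginning of slot `t`, as random variables. -/
def run (sys : System N U F) (V : ℝ) (solve : ℕ → N → (F → ℝ) → F → Bool) {Ω : Type*}
    (θ : ℕ → U → F → Ω → Bool) (Dh : (n : N) → (f : F) → Fin (sys.hist n f) → Ω → ℕ)
    (t : ℕ) (ω : Ω) : State N F :=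
  state sys V solve (fun n f s => Dh n f s ω) (fun τ => sys.demand fun k f => θ τ k f ω) t

/-- The expected demand of a slot. -/
def meanDemand (sys : System N U F) {Ω : Type*} [MeasurableSpace Ω] (P : Measure Ω)
    (θ : ℕ → U → F → Ω → Bool) (n : N) (f : F) : ℝ :=
  ∫ ω, (sys.demand (fun k f => θ 0 k f ω) n f : ℝ) ∂P

namespace IsDemandModel

variable {sys : System N U F} {Ω : Type*} [MeasurableSpace Ω] {P : Measure Ω}
  {θ : ℕ → U → F → Ω → Bool} {Dh : (n : N) → (f : F) → Fin (sys.hist n f) → Ω → ℕ}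

theorem measurable_demand (hm : IsDemandModel sys P θ Dh) (t : ℕ) :
    Measurable fun ω => sys.demand fun k f => θ t k f ω := by
  have h1 : Measurable fun ω => (fun (k : U) (f : F) => θ t k f ω) :=
    measurable_pi_iff.2 fun k => measurable_pi_iff.2 fun f => hm.measurable_request t k f
  have h2 : Measurable (sys.demand : (U → F → Bool) → N → F → ℕ) := Measurable.of_discrete
  exact h2.comp h1

theorem measurable_offline_all (hm : IsDemandModel sys P θ Dh) :
    Measurable fun ω n f s => Dh n f s ω :=
  measurable_pi_iff.2 fun n => measurable_pi_iff.2 fun f => measurable_pi_iff.2 fun s =>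
    hm.measurable_offline n f s

variable [IsProbabilityMeasure P]

/-- The demands of a slot are independent of everything observed before. -/
theorem indepFun_past (hm : IsDemandModel sys P θ Dh) (t : ℕ) :
    IndepFun (fun ω => ((fun n f s => Dh n f s ω),
      (fun s : Fin t => sys.demand fun k f => θ s k f ω)))
      (fun ω => sys.demand fun k f => θ t k f ω) P := by
  have mp : Measurable fun ω => (fun s : Fin t => sys.demand fun k f => θ s k f ω) :=
    measurable_pi_iff.2 fun s => hm.measurable_demand s
  refine indepFun_prodMk_of_indepFun hm.measurable_offline_all mp (hm.measurable_demand t) ?_ ?_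
  · exact hm.indep_offline_online.comp
      (ψ := fun d : ℕ → N → F → ℕ => ((fun s : Fin t => d s), d t)) measurable_id
      ((measurable_pi_iff.2 fun s => measurable_pi_apply _).prodMk (measurable_pi_apply _))
  · have := hm.indep_online.indepFun_finset (Finset.range t) {t} (by simp)
      hm.measurable_demand
    exact this.comp
      (φ := fun (d : Finset.range t → N → F → ℕ) (s : Fin t) => d ⟨s, Finset.mem_range.2 s.2⟩)
      (ψ := fun d : ({t} : Finset ℕ) → N → F → ℕ => d ⟨t, Finset.mem_singleton_self t⟩)
      (measurable_pi_iff.2 fun s => measurable_pi_apply _) (measurable_pi_apply _)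

/-- The factorization goes through a countable discrete space, so every function of the state is
measurable and nothing has to be assumed of `solve`. -/
theorem exists_run_eq (sys : System N U F) (V : ℝ) (solve : ℕ → N → (F → ℝ) → F → Bool)
    (θ : ℕ → U → F → Ω → Bool) (Dh : (n : N) → (f : F) → Fin (sys.hist n f) → Ω → ℕ) (t : ℕ) :
    ∃ G : ((n : N) → (f : F) → Fin (sys.hist n f) → ℕ) × (Fin t → N → F → ℕ) → State N F,
      ∀ ω, run sys V solve θ Dh t ω = G ((fun n f s => Dh n f s ω),
        (fun s : Fin t => sys.demand fun k f => θ s k f ω)) :=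
  -- The demands from slot t on are filled with 0; they cannot influence the state at time t.
  ⟨fun p => state sys V solve p.1 (fun s => if hs : s < t then p.2 ⟨s, hs⟩ else 0) t, fun ω =>
    state_congr sys V solve _ _ _ t fun s hs => by simp [hs]⟩

variable (V : ℝ) (solve : ℕ → N → (F → ℝ) → F → Bool)

theorem indepFun_run (hm : IsDemandModel sys P θ Dh) {β : Type*} [MeasurableSpace β] (t : ℕ)
    (Φ : State N F → β) :
    IndepFun (fun ω => Φ (run sys V solve θ Dh t ω))
      (fun ω => sys.demand fun k f => θ t k f ω) P := by
  obtain ⟨G, hG⟩ := exists_run_eq sys V solve θ Dh t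
  simp only [hG]
  exact (hm.indepFun_past t).comp (φ := fun p => Φ (G p)) Measurable.of_discrete measurable_id

theorem measurable_run (hm : IsDemandModel sys P θ Dh) {β : Type*} [MeasurableSpace β] (t : ℕ)
    (Φ : State N F → β) : Measurable fun ω => Φ (run sys V solve θ Dh t ω) := by
  obtain ⟨G, hG⟩ := exists_run_eq sys V solve θ Dh t
  simp only [hG]
  exact (Measurable.of_discrete (f := fun p => Φ (G p))).comp
    (hm.measurable_offline_all.prodMk (measurable_pi_iff.2 fun s => hm.measurable_demand s))

theorem measurable_demand_apply (hm : IsDemandModel sys P θ Dh) (t : ℕ) (n : N) (f : F) :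
    Measurable fun ω => (sys.demand (fun k f => θ t k f ω) n f : ℝ) :=
  (Measurable.of_discrete (f := fun d : N → F → ℕ => (d n f : ℝ))).comp (hm.measurable_demand t)

theorem integral_demand (hm : IsDemandModel sys P θ Dh) (t : ℕ) (n : N) (f : F) :
    ∫ ω, (sys.demand (fun k f => θ t k f ω) n f : ℝ) ∂P = meanDemand sys P θ n f :=
  ((hm.identDistrib_online t).comp
    (Measurable.of_discrete (f := fun d : N → F → ℕ => (d n f : ℝ)))).integral_eq

theorem demand_mem_Icc (θ : ℕ → U → F → Ω → Bool) (t : ℕ) (n : N) (f : F) (ω : Ω) :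
    (sys.demand (fun k f => θ t k f ω) n f : ℝ) ∈ Set.Icc (0 : ℝ) (sys.numUsers n) :=
  ⟨by positivity, by exact_mod_cast demand_le_numUsers sys _ n f⟩

theorem integrable_demand (hm : IsDemandModel sys P θ Dh) (t : ℕ) (n : N) (f : F) :
    Integrable (fun ω => (sys.demand (fun k f => θ t k f ω) n f : ℝ)) P :=
  Integrable.of_mem_Icc 0 (sys.numUsers n) (hm.measurable_demand_apply t n f).aemeasurable
    (Eventually.of_forall fun ω => demand_mem_Icc θ t n f ω)

theorem meanDemand_mem_Icc (hm : IsDemandModel sys P θ Dh) (n : N) (f : F) :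
    meanDemand sys P θ n f ∈ Set.Icc (0 : ℝ) (sys.numUsers n) := by
  refine ⟨integral_nonneg fun ω => (demand_mem_Icc θ 0 n f ω).1, ?_⟩
  have := integral_mono (hm.integrable_demand 0 n f)
    (integrable_const (μ := P) (sys.numUsers n : ℝ)) fun ω => (demand_mem_Icc θ 0 n f ω).2
  simpa [meanDemand] using this

theorem identDistrib_offline_real (hm : IsDemandModel sys P θ Dh) (n : N) (f : F)
    (s : Fin (sys.hist n f)) : IdentDistrib (fun ω => (Dh n f s ω : ℝ))
      (fun ω => (sys.demand (fun k f => θ 0 k f ω) n f : ℝ)) P P :=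
  (hm.identDistrib_offline n f s).comp (Measurable.of_discrete (f := fun d : ℕ => (d : ℝ)))

theorem offline_mem_Icc (hm : IsDemandModel sys P θ Dh) (n : N) (f : F)
    (s : Fin (sys.hist n f)) :
    ∀ᵐ ω ∂P, (Dh n f s ω : ℝ) ∈ Set.Icc (0 : ℝ) (sys.numUsers n) :=
  (hm.identDistrib_offline_real n f s).symm.ae_mem_snd measurableSet_Icc
    (Eventually.of_forall fun ω => demand_mem_Icc θ 0 n f ω)

theorem integral_offline (hm : IsDemandModel sys P θ Dh) (n : N) (f : F)
    (s : Fin (sys.hist n f)) : ∫ ω, (Dh n f s ω : ℝ) ∂P = meanDemand sys P θ n f :=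
  (hm.identDistrib_offline_real n f s).integral_eq

theorem measurable_offline_real (hm : IsDemandModel sys P θ Dh) (n : N) (f : F)
    (s : Fin (sys.hist n f)) : Measurable fun ω => (Dh n f s ω : ℝ) :=
  (Measurable.of_discrete (f := fun d : ℕ => (d : ℝ))).comp (hm.measurable_offline n f s)

theorem iIndepFun_offline_centered (hm : IsDemandModel sys P θ Dh) (n : N) (f : F) :
    iIndepFun (fun s ω => (Dh n f s ω : ℝ) - meanDemand sys P θ n f) P :=
  (hm.indep_offline n f).comp (fun _ d => (d : ℝ) - meanDemand sys P θ n f)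
    fun _ => Measurable.of_discrete

theorem integral_exp_offline_le (hm : IsDemandModel sys P θ Dh) (n : N) (f : F) (l : ℝ) :
    ∫ ω, Real.exp (l * ∑ s, ((Dh n f s ω : ℝ) - meanDemand sys P θ n f)) ∂P
      ≤ Real.exp (l ^ 2 * (sys.numUsers n : ℝ) ^ 2 / 8 * sys.hist n f) := by
  have h1 : ∀ s : Fin (sys.hist n f), HasSubgaussianMGF
      (fun ω => (Dh n f s ω : ℝ) - meanDemand sys P θ n f)
      ((‖(sys.numUsers n : ℝ) - 0‖₊ / 2) ^ 2) P := fun s => by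
    have := hasSubgaussianMGF_of_mem_Icc (hm.measurable_offline_real n f s).aemeasurable
      (hm.offline_mem_Icc n f s)
    rwa [hm.integral_offline] at this
  have h2 := (HasSubgaussianMGF.sum_of_iIndepFun (hm.iIndepFun_offline_centered n f)
    (s := Finset.univ) fun s _ => h1 s).mgf_le l
  refine h2.trans (le_of_eq ?_)
  congr 1
  simp
  ring

/-- Independence makes the variances add, and a variable in an interval of length K has variance at
most K²/4. -/
theorem integral_sq_offline_le (hm : IsDemandModel sys P θ Dh) (n : N) (f : F) :
    ∫ ω, (∑ s, ((Dh n f s ω : ℝ) - meanDemand sys P θ n f)) ^ 2 ∂P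
      ≤ sys.hist n f * ((sys.numUsers n : ℝ) ^ 2 / 4) := by
  have hmem : ∀ s : Fin (sys.hist n f), ∀ᵐ ω ∂P,
      (Dh n f s ω : ℝ) - meanDemand sys P θ n f ∈ Set.Icc (0 - meanDemand sys P θ n f)
        (sys.numUsers n - meanDemand sys P θ n f) := fun s =>
    (hm.offline_mem_Icc n f s).mono fun ω hω => ⟨sub_le_sub_right hω.1 _, sub_le_sub_right hω.2 _⟩
  have hmeas : ∀ s : Fin (sys.hist n f),
      Measurable fun ω => (Dh n f s ω : ℝ) - meanDemand sys P θ n f := fun s =>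
    (hm.measurable_offline_real n f s).sub_const _
  have hvar := IndepFun.variance_sum (s := Finset.univ) (μ := P)
    (X := fun s ω => (Dh n f s ω : ℝ) - meanDemand sys P θ n f)
    (fun s _ => memLp_of_bounded (hmem s) (hmeas s).aestronglyMeasurable 2)
    (fun i _ j _ hij => (hm.iIndepFun_offline_centered n f).indepFun hij)
  have hint : ∀ s : Fin (sys.hist n f),
      Integrable (fun ω => (Dh n f s ω : ℝ) - meanDemand sys P θ n f) P := fun s =>
    Integrable.of_mem_Icc _ _ (hmeas s).aemeasurable (hmem s)
  have hint' : ∀ s : Fin (sys.hist n f), Integrable (fun ω => (Dh n f s ω : ℝ)) P := fun s =>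
    Integrable.of_mem_Icc _ _ (hm.measurable_offline_real n f s).aemeasurable
      (hm.offline_mem_Icc n f s)
  have hmean : ∫ ω, (∑ s, fun ω => (Dh n f s ω : ℝ) - meanDemand sys P θ n f) ω ∂P = 0 := by
    simp only [Finset.sum_apply]
    rw [integral_finsetSum _ fun s _ => hint s]
    refine Finset.sum_eq_zero fun s _ => ?_
    rw [integral_sub (hint' s) (integrable_const _), hm.integral_offline]
    simp
  rw [variance_of_integral_eq_zero
    (Finset.univ.aemeasurable_sum fun s _ => (hmeas s).aemeasurable) hmean] at hvar
  simp only [Finset.sum_apply] at hvar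
  rw [hvar]
  calc _ ≤ ∑ s : Fin (sys.hist n f), ((sys.numUsers n : ℝ) / 2) ^ 2 := by
        refine Finset.sum_le_sum fun s _ =>
          (variance_le_sq_of_bounded (hmem s) (hmeas s).aemeasurable).trans (le_of_eq ?_)
        ring
    _ = _ := by
        rw [Finset.sum_const, Finset.card_univ, Fintype.card_fin, nsmul_eq_mul]; ring

/-- The deviation of the observed total demand for a file from its mean is a sampled walk. -/
theorem sampledWalk (hm : IsDemandModel sys P θ Dh) (n : N) (f : F) :
    SampledWalk P (sys.numUsers n) (sys.hist n f)
      (fun t ω => (run sys V solve θ Dh t ω).total n f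
        - meanDemand sys P θ n f * ((run sys V solve θ Dh t ω).count n f + sys.hist n f))
      (fun t ω => (run sys V solve θ Dh t ω).count n f)
      (fun t ω => placement sys V solve t (run sys V solve θ Dh t ω) n f)
      (fun t ω => (sys.demand (fun k f => θ t k f ω) n f : ℝ) - meanDemand sys P θ n f) := by
  have hd := hm.meanDemand_mem_Icc n f
  have hinit : ∀ ω, (run sys V solve θ Dh 0 ω).total n f
      - meanDemand sys P θ n f * ((run sys V solve θ Dh 0 ω).count n f + sys.hist n f)
      = ∑ s, ((Dh n f s ω : ℝ) - meanDemand sys P θ n f) := fun ω => by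
    simp [run, state, mul_comm]
  have habs : ∀ y ∈ Set.Icc (0 : ℝ) (sys.numUsers n),
      |y - meanDemand sys P θ n f| ≤ sys.numUsers n := fun y hy =>
    abs_sub_le_of_nonneg_of_le hy.1 hy.2 hd.1 hd.2
  have hmeas : ∀ t, Measurable fun ω =>
      (sys.demand (fun k f => θ t k f ω) n f : ℝ) - meanDemand sys P θ n f := fun t =>
    (hm.measurable_demand_apply t n f).sub_const _
  have hmean : ∀ t, ∫ ω, ((sys.demand (fun k f => θ t k f ω) n f : ℝ)
      - meanDemand sys P θ n f) ∂P = 0 := fun t => by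
    rw [integral_sub (hm.integrable_demand t n f) (integrable_const _), hm.integral_demand]
    simp
  exact
  { bound_nonneg := by positivity
    measurable_walk := fun t => hm.measurable_run V solve t fun st =>
      st.total n f - meanDemand sys P θ n f * (st.count n f + sys.hist n f)
    measurable_count := fun t => hm.measurable_run V solve t fun st => st.count n f
    measurable_pick := fun t => hm.measurable_run V solve t fun st => placement sys V solve t st n f
    measurable_noise := hmeas
    walk_succ := fun t ω => by simp only [run, state]; push_cast; ring
    count_zero := fun ω => rfl
    count_succ := fun t ω => rfl
    indep := fun t => (hm.indepFun_run V solve t fun st =>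
      (st.total n f - meanDemand sys P θ n f * (st.count n f + sys.hist n f), st.count n f,
        placement sys V solve t st n f)).comp measurable_id
          (Measurable.of_discrete (f := fun d : N → F → ℕ => (d n f : ℝ) - meanDemand sys P θ n f))
    noise_abs_le := fun t ω => habs _ (demand_mem_Icc θ t n f ω)
    noise_mean := hmean
    noise_sq := fun t => by
      rw [← variance_of_integral_eq_zero (hmeas t).aemeasurable (hmean t)]
      refine (variance_le_sq_of_bounded (μ := P) (a := 0 - meanDemand sys P θ n f)
        (b := sys.numUsers n - meanDemand sys P θ n f) (Eventually.of_forall fun ω =>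
        ⟨sub_le_sub_right (demand_mem_Icc θ t n f ω).1 _,
          sub_le_sub_right (demand_mem_Icc θ t n f ω).2 _⟩)
        (hmeas t).aemeasurable).trans (le_of_eq ?_)
      ring
    noise_mgf := fun t l => by
      have h1 := hasSubgaussianMGF_of_mem_Icc (μ := P) (hm.measurable_demand_apply t n f).aemeasurable
        (Eventually.of_forall fun ω => demand_mem_Icc θ t n f ω)
      rw [hm.integral_demand] at h1
      refine (h1.mgf_le l).trans (le_of_eq ?_)
      congr 1
      simp
      ring
    init_bdd := by
      refine ⟨∑ _s : Fin (sys.hist n f), (sys.numUsers n : ℝ), ?_⟩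
      filter_upwards [ae_all_iff.2 fun s => hm.offline_mem_Icc n f s] with ω hω
      rw [hinit]
      exact (Finset.abs_sum_le_sum_abs _ _).trans (Finset.sum_le_sum fun s _ => habs _ (hω s))
    init_zero := fun h0 ω => by
      rw [hinit]
      have : IsEmpty (Fin (sys.hist n f)) := by rw [h0]; infer_instance
      simp
    init_sq := by
      simp only [hinit]; exact hm.integral_sq_offline_le n f
    init_mgf := fun l => by
      simp only [hinit]; exact hm.integral_exp_offline_le n f l }

end IsDemandModel
-- Pointwise bounds of the estimates and total underestimation
theorem System.histMin_le (sys : System N U F) (n : N) (f : F) : sys.histMin ≤ sys.hist n f :=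
  ciInf_le (OrderBot.bddBelow (Set.range fun p : N × F => sys.hist p.1 p.2)) (n, f)

theorem estimate_le (sys : System N U F) (t : ℕ) (st : State N F) (n : N) (f : F) :
    estimate sys t st n f ≤ sys.numUsers n := by
  unfold estimate; split_ifs
  · exact min_le_right _ _
  · exact le_rfl

theorem estimate_nonneg (sys : System N U F) (t : ℕ) (st : State N F) (n : N) (f : F)
    (hst : 0 ≤ st.total n f) : 0 ≤ estimate sys t st n f := by
  unfold estimate; split_ifs <;> positivity

theorem state_total_nonneg (sys : System N U F) (V : ℝ) (solve : ℕ → N → (F → ℝ) → F → Bool)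
    (Dh : (n : N) → (f : F) → Fin (sys.hist n f) → ℕ) (D : ℕ → N → F → ℕ) (t : ℕ) (n : N) (f : F) :
    0 ≤ (state sys V solve Dh D t).total n f := by
  induction t with
  | zero => simp only [state]; positivity
  | succ t ih => simp only [state]; positivity

theorem sum_size_mul_le_of_fits (sys : System N U F) {n : N} {x : F → Bool} (hx : sys.Fits n x) :
    ∑ f, (sys.size f : ℝ) * (x f).toNat ≤ sys.cap n := by exact_mod_cast hx

/-- Telescoping of 1/(t+2)² ≤ 1/(t+1) - 1/(t+2); the shift is there because the deviation bound is
summed from slot 2 on. -/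
theorem sum_two_div_sq_le (T : ℕ) :
    ∑ t ∈ Finset.range T, 2 / ((t : ℝ) + 2) ^ 2 ≤ 2 - 2 / ((T : ℝ) + 1) := by
  induction T with
  | zero => norm_num
  | succ T ih =>
    rw [Finset.sum_range_succ]
    have : 2 / ((T : ℝ) + 2) ^ 2 ≤ 2 / ((T : ℝ) + 1) - 2 / ((T : ℝ) + 2) := by
      rw [div_sub_div _ _ (by positivity) (by positivity), div_le_div_iff₀ (by positivity)
        (by positivity)]
      nlinarith [(Nat.cast_nonneg T : (0 : ℝ) ≤ T)]
    have e : ((T + 1 : ℕ) : ℝ) + 1 = (T : ℝ) + 2 := by push_cast; ring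
    rw [e]; linarith

/-- Upper bound of the estimation error in terms of the deviation of the observed total demand. -/
theorem estimate_sub_le (sys : System N U F) (t T : ℕ) (ht : 1 ≤ t) (htT : t < T)
    (st : State N F) (n : N) (f : F) {d : ℝ} (hd : 0 ≤ d) :
    estimate sys t st n f - d ≤
      sys.numUsers n * (Real.sqrt (6 * Real.log T) / 2) *
          confidenceWidth (st.count n f + sys.hist n f)
        + |st.total n f - d * (st.count n f + sys.hist n f)| / (st.count n f + sys.hist n f) := by
  have ht' : (1 : ℝ) ≤ t := by exact_mod_cast ht
  have htT' : (t : ℝ) ≤ T := by exact_mod_cast htT.le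
  have hT2 : (2 : ℝ) ≤ T := by exact_mod_cast (by omega : 2 ≤ T)
  have hlog : Real.log t ≤ Real.log T := Real.log_le_log (by linarith) htT'
  have hlogT : 4 ≤ 6 * Real.log T := by
    have := Real.log_le_log (by norm_num) hT2
    linarith [Real.log_two_gt_d9]
  rcases Nat.eq_zero_or_pos (st.count n f + sys.hist n f) with hm | hm
  -- Without observations the estimate is K. The default width 1 absorbs it, since 6 log T ≥ 4 for T
  -- ≥ 2.
  · have h2 : 1 ≤ Real.sqrt (6 * Real.log T) / 2 := by
      rw [le_div_iff₀ (by norm_num)]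
      exact Real.le_sqrt_of_sq_le (by linarith)
    have hm' : (st.count n f : ℝ) + sys.hist n f = 0 := by exact_mod_cast hm
    rw [hm, hm', confidenceWidth, if_pos rfl, div_zero, mul_one, add_zero]
    have h3 := estimate_le sys t st n f
    have h4 := le_mul_of_one_le_right (Nat.cast_nonneg (α := ℝ) (sys.numUsers n)) h2
    linarith
  · rw [confidenceWidth, if_neg hm.ne', estimate, if_pos ⟨ht, hm⟩]
    have hm' : (0 : ℝ) < (st.count n f : ℝ) + sys.hist n f := by exact_mod_cast hm
    push_cast
    set m := (st.count n f : ℝ) + sys.hist n f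
    have e1 : Real.sqrt (3 * Real.log t / (2 * m))
        ≤ Real.sqrt (6 * Real.log T) / 2 * (1 / Real.sqrt m) := by
      have h4 : Real.sqrt 4 = 2 := by
        rw [show (4 : ℝ) = 2 ^ 2 by norm_num]; exact Real.sqrt_sq (by norm_num)
      have e : Real.sqrt (6 * Real.log T) / 2 * (1 / Real.sqrt m)
          = Real.sqrt (6 * Real.log T / (4 * m)) := by
        rw [Real.sqrt_div (by linarith), Real.sqrt_mul (by norm_num) m, h4]
        ring
      rw [e]
      refine Real.sqrt_le_sqrt ?_
      rw [div_le_div_iff₀ (by positivity) (by positivity)]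
      nlinarith
    have e2 : st.total n f / m = (st.total n f - d * m) / m + d := by field_simp; ring
    have e3 : (st.total n f - d * m) / m ≤ |st.total n f - d * m| / m := by
      gcongr; exact le_abs_self _
    calc _ ≤ st.total n f / m + sys.numUsers n * Real.sqrt (3 * Real.log t / (2 * m)) - d := by
          gcongr; exact min_le_left _ _
      _ ≤ st.total n f / m + sys.numUsers n *
            (Real.sqrt (6 * Real.log T) / 2 * (1 / Real.sqrt m)) - d := by gcongr
      _ ≤ _ := by rw [e2]; linarith

namespace IsDemandModel

variable {sys : System N U F} {Ω : Type*} [MeasurableSpace Ω] {P : Measure Ω}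
  [IsProbabilityMeasure P]
  {θ : ℕ → U → F → Ω → Bool} {Dh : (n : N) → (f : F) → Fin (sys.hist n f) → Ω → ℕ}
  (V : ℝ) (solve : ℕ → N → (F → ℝ) → F → Bool)

theorem estimate_mem_Icc (θ : ℕ → U → F → Ω → Bool)
    (Dh : (n : N) → (f : F) → Fin (sys.hist n f) → Ω → ℕ) (t : ℕ) (n : N) (f : F) (ω : Ω) :
    estimate sys t (run sys V solve θ Dh t ω) n f ∈ Set.Icc (0 : ℝ) (sys.numUsers n) :=
  ⟨estimate_nonneg _ _ _ _ _ (state_total_nonneg _ _ _ _ _ _ _ _), estimate_le _ _ _ _ _⟩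

theorem integrable_estimate (hm : IsDemandModel sys P θ Dh) (t : ℕ) (n : N) (f : F) :
    Integrable (fun ω => estimate sys t (run sys V solve θ Dh t ω) n f) P :=
  Integrable.of_mem_Icc 0 (sys.numUsers n)
    (hm.measurable_run V solve t fun st => estimate sys t st n f).aemeasurable
    (Eventually.of_forall fun ω => estimate_mem_Icc V solve θ Dh t n f ω)

/-- The total expected underestimation of a popularity is bounded. -/
theorem sum_integral_sub_estimate_le (hm : IsDemandModel sys P θ Dh) (n : N) (f : F) (T : ℕ) :
    ∑ t ∈ Finset.range T,
      ∫ ω, (meanDemand sys P θ n f - estimate sys t (run sys V solve θ Dh t ω) n f) ∂P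
      ≤ 3 * sys.numUsers n := by
  have hd := hm.meanDemand_mem_Icc n f
  have hint : ∀ t, Integrable (fun ω => meanDemand sys P θ n f
      - estimate sys t (run sys V solve θ Dh t ω) n f) P := fun t =>
    (integrable_const _).sub (hm.integrable_estimate V solve t n f)
  have hle : ∀ t ω, meanDemand sys P θ n f
      - estimate sys t (run sys V solve θ Dh t ω) n f ≤ sys.numUsers n := fun t ω => by
    linarith [hd.2, (estimate_mem_Icc V solve θ Dh t n f ω).1]
  have h0 : ∫ ω, (meanDemand sys P θ n f
      - estimate sys 0 (run sys V solve θ Dh 0 ω) n f) ∂P ≤ 0 := by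
    refine integral_nonpos fun ω => ?_
    simp only [estimate, lt_irrefl, false_and, if_false, Pi.zero_apply]
    linarith [hd.2]
  have h1 : ∀ t, ∫ ω, (meanDemand sys P θ n f
      - estimate sys t (run sys V solve θ Dh t ω) n f) ∂P ≤ sys.numUsers n := fun t => by
    have := integral_mono (hint t) (integrable_const (μ := P) (sys.numUsers n : ℝ)) (hle t)
    simpa using this
  have h2 : ∀ t, 1 ≤ t → ∫ ω, (meanDemand sys P θ n f
      - estimate sys t (run sys V solve θ Dh t ω) n f) ∂P ≤ 2 * sys.numUsers n / (t : ℝ) ^ 2 := by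
    intro t ht
    refine (hm.sampledWalk V solve n f).integral_le_of_pos_imp t ht (hint t) (hle t) fun ω hω => ?_
    by_cases hc : 0 < t ∧ 0 < (run sys V solve θ Dh t ω).count n f + sys.hist n f
    · refine ⟨hc.2, ?_⟩
      rw [estimate, if_pos hc] at hω
      have hm' : (0 : ℝ) < ((run sys V solve θ Dh t ω).count n f : ℝ) + sys.hist n f := by
        exact_mod_cast hc.2
      set m := ((run sys V solve θ Dh t ω).count n f : ℝ) + sys.hist n f
      -- The truncation at K cannot cause an underestimate because the mean is at most K, so the
      -- untruncated index itself lies below the mean.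
      rcases min_lt_iff.1 (sub_pos.1 hω) with h | h
      · have h3 := mul_lt_mul_of_pos_left h hm'
        rw [mul_add, mul_div_cancel₀ _ hm'.ne'] at h3
        linarith
      · exact absurd h (not_lt.2 hd.2)
    · rw [estimate, if_neg hc] at hω
      linarith [hd.2]
  have hK : (0 : ℝ) ≤ sys.numUsers n := by positivity
  -- Slot 0 contributes nothing positive, slot 1 at most K, and the later slots at most ∑ 2K/t² ≤
  -- 2K.
  match T with
  | 0 => simp
  | 1 => rw [Finset.sum_range_one]; linarith
  | T + 2 =>
    rw [Finset.sum_range_succ', Finset.sum_range_succ']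
    have h3 : ∑ t ∈ Finset.range T, ∫ ω, (meanDemand sys P θ n f
        - estimate sys (t + 1 + 1) (run sys V solve θ Dh (t + 1 + 1) ω) n f) ∂P
        ≤ 2 * sys.numUsers n := by
      calc _ ≤ ∑ t ∈ Finset.range T, (sys.numUsers n : ℝ) * (2 / ((t : ℝ) + 2) ^ 2) := by
            refine Finset.sum_le_sum fun t _ => (h2 (t + 1 + 1) (by omega)).trans (le_of_eq ?_)
            push_cast; ring
        _ = (sys.numUsers n : ℝ) * ∑ t ∈ Finset.range T, 2 / ((t : ℝ) + 2) ^ 2 := by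
            rw [Finset.mul_sum]
        _ ≤ (sys.numUsers n : ℝ) * 2 := by
            gcongr
            refine (sum_two_div_sq_le T).trans ?_
            have : 0 ≤ 2 / ((T : ℝ) + 1) := by positivity
            linarith
        _ = _ := by ring
    linarith [h1 (0 + 1)]

end IsDemandModel
-- Total overestimation of the cached files
namespace IsDemandModel

variable {sys : System N U F} {Ω : Type*} [MeasurableSpace Ω] {P : Measure Ω}
  [IsProbabilityMeasure P]
  {θ : ℕ → U → F → Ω → Bool} {Dh : (n : N) → (f : F) → Fin (sys.hist n f) → Ω → ℕ}
  (V : ℝ) (solve : ℕ → N → (F → ℝ) → F → Bool)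

/-- The total absolute error of the sampled means of the cached files. -/
theorem integral_sum_abs_deviation_le (hm : IsDemandModel sys P θ Dh)
    (hsolve : ∀ t n w, IsOptimalPlacement sys n w (solve t n w)) (n : N) (T : ℕ) (hT : 2 ≤ T) :
    ∑ t ∈ Finset.range T, ∑ f, ∫ ω, (sys.size f : ℝ) *
      ((placement sys V solve t (run sys V solve θ Dh t ω) n f).toNat *
        (|(run sys V solve θ Dh t ω).total n f - meanDemand sys P θ n f *
          ((run sys V solve θ Dh t ω).count n f + sys.hist n f)|
          / ((run sys V solve θ Dh t ω).count n f + sys.hist n f))) ∂P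
      ≤ sys.numUsers n * Real.sqrt (6 * sys.cap n * ∑ f, (sys.size f : ℝ)) *
        Real.sqrt (Real.log T / ((T : ℝ) + sys.histMin)) * T := by
  set K : ℝ := (sys.numUsers n : ℝ)
  set H₀ : ℝ := (sys.histMin : ℝ)
  set S : ℝ := ∑ f, (sys.size f : ℝ)
  set x : ℕ → F → Ω → ℝ := fun t f ω =>
    ((placement sys V solve t (run sys V solve θ Dh t ω) n f).toNat : ℝ)
  set m : ℕ → F → Ω → ℝ := fun t f ω => ((run sys V solve θ Dh t ω).count n f : ℝ) + sys.hist n f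
  set M : ℕ → F → Ω → ℝ := fun t f ω => (run sys V solve θ Dh t ω).total n f
    - meanDemand sys P θ n f * m t f ω
  have hK : 0 ≤ K := by positivity
  have hT0 : (0 : ℝ) < T := by exact_mod_cast (by omega : 0 < T)
  have hlog : 0 ≤ Real.log T := Real.log_natCast_nonneg T
  have hH₀ : 0 ≤ H₀ := by positivity
  have hS : 0 ≤ S := by positivity
  set B : ℝ := S * (6 * K ^ 2 * Real.log T * (T / (T + H₀)))
  have hB : 0 ≤ B := by positivity
  have goal_eq : K * Real.sqrt (6 * sys.cap n * S) * Real.sqrt (Real.log T / (T + H₀)) * T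
      = Real.sqrt (sys.cap n * T * B) := by
    rw [show sys.cap n * T * B = (K * T) ^ 2 *
      ((6 * sys.cap n * S) * (Real.log T / (T + H₀))) by simp only [B]; ring,
      Real.sqrt_mul (sq_nonneg (K * T)), Real.sqrt_sq (by positivity),
      Real.sqrt_mul (show 0 ≤ 6 * (sys.cap n : ℝ) * S by positivity)]
    ring
  have hxint : ∀ t f, Integrable (fun ω => x t f ω) P := fun t f =>
    (hm.sampledWalk V solve n f).integrable_comp t (F := fun _ _ b => (b.toNat : ℝ))
      fun _ _ => continuous_const
  have haint : ∀ t f, Integrable (fun ω => x t f ω * (|M t f ω| / m t f ω)) P := fun t f =>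
    (hm.sampledWalk V solve n f).integrable_comp t
      (F := fun y k b => (b.toNat : ℝ) * (|y| / ((k : ℝ) + sys.hist n f)))
      fun _ _ => by fun_prop
  have hsint : ∀ t f, Integrable (fun ω => x t f ω * (M t f ω ^ 2 / m t f ω ^ 2)) P := fun t f =>
    (hm.sampledWalk V solve n f).integrable_pick_mul_sq_div t
  have hcap : ∑ t ∈ Finset.range T, ∑ f, (sys.size f : ℝ) * ∫ ω, x t f ω ∂P ≤ sys.cap n * T := by
    have : ∀ t, ∑ f, (sys.size f : ℝ) * ∫ ω, x t f ω ∂P ≤ sys.cap n := fun t => by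
      simp_rw [← integral_const_mul]
      rw [← integral_finsetSum _ fun f _ => (hxint t f).const_mul _]
      have := integral_mono (integrable_finsetSum _ fun f (_ : f ∈ Finset.univ) =>
        (hxint t f).const_mul (sys.size f : ℝ)) (integrable_const (μ := P) (sys.cap n : ℝ))
        fun ω => sum_size_mul_le_of_fits sys (hsolve t n _).1
      simpa using this
    calc _ ≤ ∑ t ∈ Finset.range T, (sys.cap n : ℝ) := Finset.sum_le_sum fun t _ => this t
      _ = _ := by simp [mul_comm]
  have hsq : ∑ t ∈ Finset.range T, ∑ f, (sys.size f : ℝ) *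
      ∫ ω, x t f ω * (M t f ω ^ 2 / m t f ω ^ 2) ∂P ≤ B := by
    rw [Finset.sum_comm]
    simp only [B, S, Finset.sum_mul]
    refine Finset.sum_le_sum fun f _ => ?_
    rw [← Finset.mul_sum]
    refine mul_le_mul_of_nonneg_left ?_ (by positivity)
    refine ((hm.sampledWalk V solve n f).sum_integral_sq_div_le T hT).trans ?_
    have : H₀ ≤ sys.hist n f := Nat.cast_le.2 (sys.histMin_le n f)
    gcongr
  rw [goal_eq]
  -- Cauchy-Schwarz over slots, files and outcomes at once, with weight size times pick. The total
  -- weight is at most `cap n * T` by `hcap`, and the weighted squares sum to at most `B` by `hsq`.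
  refine le_sqrt_mul_of_forall_le (by positivity) hB fun c hc => ?_
  have hpt : ∀ t f ω, 2 * (x t f ω * (|M t f ω| / m t f ω))
      ≤ c * x t f ω + x t f ω * (M t f ω ^ 2 / m t f ω ^ 2) / c := fun t f ω => by
    have hx : 0 ≤ x t f ω := Nat.cast_nonneg _
    have e : M t f ω ^ 2 / m t f ω ^ 2 = (|M t f ω| / m t f ω) ^ 2 := by rw [div_pow, sq_abs]
    rw [e]
    set u := |M t f ω| / m t f ω
    have : 2 * u ≤ c + u ^ 2 / c := by
      rw [← sub_nonneg]
      have : c + u ^ 2 / c - 2 * u = (c - u) ^ 2 / c := by field_simp; ring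
      rw [this]; positivity
    calc 2 * (x t f ω * u) = x t f ω * (2 * u) := by ring
      _ ≤ x t f ω * (c + u ^ 2 / c) := by gcongr
      _ = _ := by ring
  have hterm : ∀ t f, 2 * ∫ ω, (sys.size f : ℝ) * (x t f ω * (|M t f ω| / m t f ω)) ∂P
      ≤ c * ((sys.size f : ℝ) * ∫ ω, x t f ω ∂P)
        + ((sys.size f : ℝ) * ∫ ω, x t f ω * (M t f ω ^ 2 / m t f ω ^ 2) ∂P) / c := fun t f => by
    have h1 := integral_mono ((haint t f).const_mul 2)
      (((hxint t f).const_mul c).add ((hsint t f).div_const c)) (hpt t f)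
    have h2 : ∫ ω, (c * x t f ω + x t f ω * (M t f ω ^ 2 / m t f ω ^ 2) / c) ∂P
        = c * (∫ ω, x t f ω ∂P) + (∫ ω, x t f ω * (M t f ω ^ 2 / m t f ω ^ 2) ∂P) / c := by
      rw [integral_add ((hxint t f).const_mul c) ((hsint t f).div_const c), integral_const_mul,
        integral_div]
    rw [integral_const_mul]
    have h3 : 2 * ∫ ω, x t f ω * (|M t f ω| / m t f ω) ∂P
        ≤ c * (∫ ω, x t f ω ∂P) + (∫ ω, x t f ω * (M t f ω ^ 2 / m t f ω ^ 2) ∂P) / c := by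
      rw [← integral_const_mul, ← h2]; exact h1
    have h4 := mul_le_mul_of_nonneg_left h3 (Nat.cast_nonneg (α := ℝ) (sys.size f))
    calc _ = (sys.size f : ℝ) * (2 * ∫ ω, x t f ω * (|M t f ω| / m t f ω) ∂P) := by ring
      _ ≤ _ := h4
      _ = _ := by ring
  calc _ = ∑ t ∈ Finset.range T, ∑ f,
        2 * ∫ ω, (sys.size f : ℝ) * (x t f ω * (|M t f ω| / m t f ω)) ∂P := by
        rw [Finset.mul_sum]; exact Finset.sum_congr rfl fun t _ => by rw [Finset.mul_sum]
    _ ≤ ∑ t ∈ Finset.range T, ∑ f, (c * ((sys.size f : ℝ) * ∫ ω, x t f ω ∂P)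
        + ((sys.size f : ℝ) * ∫ ω, x t f ω * (M t f ω ^ 2 / m t f ω ^ 2) ∂P) / c) :=
        Finset.sum_le_sum fun t _ => Finset.sum_le_sum fun f _ => hterm t f
    _ = c * (∑ t ∈ Finset.range T, ∑ f, (sys.size f : ℝ) * ∫ ω, x t f ω ∂P)
        + (∑ t ∈ Finset.range T, ∑ f, (sys.size f : ℝ) *
          ∫ ω, x t f ω * (M t f ω ^ 2 / m t f ω ^ 2) ∂P) / c := by
        simp only [Finset.sum_add_distrib, Finset.mul_sum, Finset.sum_div]
    _ ≤ _ := by gcongr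

/-- The total width of the confidence intervals of the cached files. -/
theorem sum_confidenceWidth_placement_le (hm : IsDemandModel sys P θ Dh)
    (hsolve : ∀ t n w, IsOptimalPlacement sys n w (solve t n w)) (n : N) (T : ℕ) (hT : 2 ≤ T)
    (ω : Ω) :
    ∑ t ∈ Finset.range T, ∑ f, (sys.size f : ℝ) *
      ((placement sys V solve t (run sys V solve θ Dh t ω) n f).toNat *
        (sys.numUsers n * (Real.sqrt (6 * Real.log T) / 2) *
          confidenceWidth ((run sys V solve θ Dh t ω).count n f + sys.hist n f)))
      ≤ sys.numUsers n * Real.sqrt (6 * sys.cap n * ∑ f, (sys.size f : ℝ)) *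
        Real.sqrt (Real.log T / ((T : ℝ) + sys.histMin)) * T := by
  have hT0 : (0 : ℝ) < T := by exact_mod_cast (by omega : 0 < T)
  have hlog : 0 ≤ Real.log T := Real.log_natCast_nonneg T
  set K : ℝ := (sys.numUsers n : ℝ)
  set a := Real.sqrt (6 * Real.log T)
  have ha : 0 ≤ a := Real.sqrt_nonneg _
  set h : F → ℕ := fun f => (run sys V solve θ Dh T ω).count n f
  have hsum : ∑ f, (sys.size f : ℝ) * (h f : ℝ) ≤ sys.cap n * T := by
    have : ∀ f, (h f : ℝ) = ∑ t ∈ Finset.range T,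
        ((placement sys V solve t (run sys V solve θ Dh t ω) n f).toNat : ℝ) := fun f => by
      have := (hm.sampledWalk V solve n f).sum_pick_mul (fun _ => 1) T ω
      simp only [mul_one] at this
      rw [this]; simp [h]
    simp only [this, Finset.mul_sum]
    rw [Finset.sum_comm]
    calc _ ≤ ∑ t ∈ Finset.range T, (sys.cap n : ℝ) :=
          Finset.sum_le_sum fun t _ => sum_size_mul_le_of_fits sys (hsolve t n _).1
      _ = _ := by simp [mul_comm]
  have h1 := sum_mul_div_sqrt_le (fun f => (sys.size f : ℝ)) (fun f => by positivity)
    (fun f => (h f : ℝ)) (fun f => (sys.hist n f : ℝ)) T (sys.cap n) sys.histMin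
    (fun f => by positivity)
    (fun f => by exact_mod_cast (hm.sampledWalk V solve n f).count_le T ω) hT0 (by positivity)
    (fun f => by exact_mod_cast sys.histMin_le n f) hsum
  have h2 : ∀ f, ∑ t ∈ Finset.range T,
      ((placement sys V solve t (run sys V solve θ Dh t ω) n f).toNat : ℝ) *
        confidenceWidth ((run sys V solve θ Dh t ω).count n f + sys.hist n f)
      ≤ 2 * (h f / Real.sqrt ((h f : ℝ) + sys.hist n f)) := fun f => by
    rw [(hm.sampledWalk V solve n f).sum_pick_mul (fun k => confidenceWidth (k + sys.hist n f))]
    exact sum_confidenceWidth_le _ _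
  have hS : (0 : ℝ) ≤ ∑ f, (sys.size f : ℝ) := by positivity
  calc _ = K * (a / 2) * ∑ f, (sys.size f : ℝ) * ∑ t ∈ Finset.range T,
          ((placement sys V solve t (run sys V solve θ Dh t ω) n f).toNat : ℝ) *
          confidenceWidth ((run sys V solve θ Dh t ω).count n f + sys.hist n f) := by
        rw [Finset.sum_comm, Finset.mul_sum]
        refine Finset.sum_congr rfl fun f _ => ?_
        simp only [Finset.mul_sum]
        exact Finset.sum_congr rfl fun t _ => by ring
    _ ≤ K * (a / 2) * ∑ f, (sys.size f : ℝ) *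
          (2 * (h f / Real.sqrt ((h f : ℝ) + sys.hist n f))) := by
        gcongr with f _
        exact h2 f
    _ = K * a * ∑ f, (sys.size f : ℝ) * (h f / Real.sqrt ((h f : ℝ) + sys.hist n f)) := by
        simp only [Finset.mul_sum]
        exact Finset.sum_congr rfl fun t _ => by ring
    _ ≤ K * a * (T * Real.sqrt (sys.cap n * (∑ f, (sys.size f : ℝ)) / (T + sys.histMin))) := by
        gcongr
    _ = K * T * (a * Real.sqrt (sys.cap n * (∑ f, (sys.size f : ℝ)) / (T + sys.histMin))) := by
        ring
    _ = K * T * (Real.sqrt (6 * sys.cap n * ∑ f, (sys.size f : ℝ)) *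
        Real.sqrt (Real.log T / ((T : ℝ) + sys.histMin))) := by
        rw [← Real.sqrt_mul (by positivity), ← Real.sqrt_mul (by positivity)]
        congr 2; ring
    _ = _ := by ring

/-- The total expected overestimation of the popularities of the cached files. -/
theorem sum_integral_estimate_sub_le (hm : IsDemandModel sys P θ Dh)
    (hsolve : ∀ t n w, IsOptimalPlacement sys n w (solve t n w)) (n : N) (T : ℕ) (hT : 1 ≤ T) :
    ∑ t ∈ Finset.range T, ∑ f, ∫ ω, (sys.size f : ℝ) *
      ((placement sys V solve t (run sys V solve θ Dh t ω) n f).toNat *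
        (estimate sys t (run sys V solve θ Dh t ω) n f - meanDemand sys P θ n f)) ∂P
      ≤ sys.numUsers n * sys.cap n +
        2 * (sys.numUsers n * Real.sqrt (6 * sys.cap n * ∑ f, (sys.size f : ℝ))) *
        Real.sqrt (Real.log T / ((T : ℝ) + sys.histMin)) * T := by
  have hd := fun f => hm.meanDemand_mem_Icc n f
  set K : ℝ := (sys.numUsers n : ℝ)
  set R : ℝ := K * Real.sqrt (6 * sys.cap n * ∑ f, (sys.size f : ℝ)) *
    Real.sqrt (Real.log T / ((T : ℝ) + sys.histMin)) * T
  have hR : 0 ≤ R := by positivity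
  have hgoal : K * sys.cap n + 2 * (K * Real.sqrt (6 * sys.cap n * ∑ f, (sys.size f : ℝ))) *
      Real.sqrt (Real.log T / ((T : ℝ) + sys.histMin)) * T = K * sys.cap n + (R + R) := by
    simp only [R]; ring
  rw [hgoal]
  set x : ℕ → F → Ω → ℝ := fun t f ω =>
    ((placement sys V solve t (run sys V solve θ Dh t ω) n f).toNat : ℝ)
  set e : ℕ → F → Ω → ℝ := fun t f ω =>
    estimate sys t (run sys V solve θ Dh t ω) n f - meanDemand sys P θ n f
  have hx0 : ∀ t f ω, 0 ≤ x t f ω := fun t f ω => Nat.cast_nonneg _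
  have hx1 : ∀ t f ω, x t f ω ≤ 1 := fun t f ω =>
    Nat.cast_le_one.2 (Bool.toNat_le _)
  have heK : ∀ t f ω, |e t f ω| ≤ K := fun t f ω =>
    abs_sub_le_of_nonneg_of_le (estimate_mem_Icc V solve θ Dh t n f ω).1
      (estimate_mem_Icc V solve θ Dh t n f ω).2 (hd f).1 (hd f).2
  have hint : ∀ t f, Integrable (fun ω => (sys.size f : ℝ) * (x t f ω * e t f ω)) P := fun t f => by
    refine Integrable.const_mul (Integrable.of_bound (hm.measurable_run V solve t fun st =>
      ((placement sys V solve t st n f).toNat : ℝ) *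
        (estimate sys t st n f - meanDemand sys P θ n f)).aestronglyMeasurable K
      (Eventually.of_forall fun ω => ?_)) _
    have h1 : |x t f ω * e t f ω| ≤ K := by
      rw [abs_mul, abs_of_nonneg (hx0 t f ω)]
      calc _ ≤ 1 * |e t f ω| := by gcongr; exact hx1 t f ω
        _ ≤ K := by rw [one_mul]; exact heK t f ω
    exact h1
  have hzero : ∑ f, ∫ ω, (sys.size f : ℝ) * (x 0 f ω * e 0 f ω) ∂P ≤ K * sys.cap n := by
    rw [← integral_finsetSum _ fun f _ => hint 0 f]
    have := integral_mono (integrable_finsetSum _ fun f (_ : f ∈ Finset.univ) => hint 0 f)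
      (integrable_const (μ := P) (K * sys.cap n)) fun ω => by
        calc ∑ f, (sys.size f : ℝ) * (x 0 f ω * e 0 f ω)
            ≤ ∑ f, (sys.size f : ℝ) * (x 0 f ω * K) := by
              gcongr with f _
              · exact (le_abs_self _).trans (heK 0 f ω)
          _ = K * ∑ f, (sys.size f : ℝ) * x 0 f ω := by
              rw [Finset.mul_sum]; exact Finset.sum_congr rfl fun f _ => by ring
          _ ≤ K * sys.cap n :=
              mul_le_mul_of_nonneg_left (sum_size_mul_le_of_fits sys (hsolve 0 n _).1)
                (Nat.cast_nonneg _)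
    simpa using this
  rcases hT.eq_or_lt with h1 | h2
  · rw [← h1, Finset.sum_range_one]
    linarith
  set w : ℕ → F → Ω → ℝ := fun t f ω => (sys.size f : ℝ) * (x t f ω *
    (K * (Real.sqrt (6 * Real.log T) / 2) *
      confidenceWidth ((run sys V solve θ Dh t ω).count n f + sys.hist n f)))
  set v : ℕ → F → Ω → ℝ := fun t f ω => (sys.size f : ℝ) * (x t f ω *
    (|(run sys V solve θ Dh t ω).total n f - meanDemand sys P θ n f *
      ((run sys V solve θ Dh t ω).count n f + sys.hist n f)|
      / ((run sys V solve θ Dh t ω).count n f + sys.hist n f)))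
  have hw0 : ∀ t f ω, 0 ≤ w t f ω := fun t f ω => by
    have := confidenceWidth_nonneg ((run sys V solve θ Dh t ω).count n f + sys.hist n f)
    have := hx0 t f ω
    positivity
  have hv0 : ∀ t f ω, 0 ≤ v t f ω := fun t f ω => by
    have := hx0 t f ω
    positivity
  have hwint : ∀ t f, Integrable (w t f) P := fun t f =>
    (hm.sampledWalk V solve n f).integrable_comp t
      (F := fun _ k b => (sys.size f : ℝ) * ((b.toNat : ℝ) *
        (K * (Real.sqrt (6 * Real.log T) / 2) * confidenceWidth (k + sys.hist n f))))
      fun _ _ => continuous_const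
  have hvint : ∀ t f, Integrable (v t f) P := fun t f =>
    (hm.sampledWalk V solve n f).integrable_comp t
      (F := fun y k b => (sys.size f : ℝ) * ((b.toNat : ℝ) * (|y| / ((k : ℝ) + sys.hist n f))))
      fun _ _ => by fun_prop
  have hW : ∑ t ∈ Finset.range T, ∑ f, ∫ ω, w t f ω ∂P ≤ R := by
    have e1 : ∑ t ∈ Finset.range T, ∑ f, ∫ ω, w t f ω ∂P
        = ∫ ω, ∑ t ∈ Finset.range T, ∑ f, w t f ω ∂P := by
      rw [integral_finsetSum _ fun t _ => integrable_finsetSum _ fun f _ => hwint t f]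
      exact Finset.sum_congr rfl fun t _ => (integral_finsetSum _ fun f _ => hwint t f).symm
    rw [e1]
    have := integral_mono (integrable_finsetSum _ fun t (_ : t ∈ Finset.range T) =>
      integrable_finsetSum _ fun f (_ : f ∈ Finset.univ) => hwint t f)
      (integrable_const (μ := P) R)
      fun ω => hm.sum_confidenceWidth_placement_le V solve hsolve n T h2 ω
    simpa using this
  have hVv : ∑ t ∈ Finset.range T, ∑ f, ∫ ω, v t f ω ∂P ≤ R :=
    hm.integral_sum_abs_deviation_le V solve hsolve n T h2
  -- Slot 0 is charged K times the capacity, as the confidence bound is only available from slot 1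
  -- on.
  have hstep : ∀ t ∈ Finset.range T, ∑ f, ∫ ω, (sys.size f : ℝ) * (x t f ω * e t f ω) ∂P
      ≤ (if t = 0 then K * sys.cap n else 0)
        + (∑ f, ∫ ω, w t f ω ∂P + ∑ f, ∫ ω, v t f ω ∂P) := by
    intro t ht
    split_ifs with ht0
    · have n1 : 0 ≤ ∑ f, ∫ ω, w t f ω ∂P :=
        Finset.sum_nonneg fun f _ => integral_nonneg fun ω => hw0 t f ω
      have n2 : 0 ≤ ∑ f, ∫ ω, v t f ω ∂P :=
        Finset.sum_nonneg fun f _ => integral_nonneg fun ω => hv0 t f ω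
      subst ht0
      linarith
    · rw [zero_add, ← Finset.sum_add_distrib]
      refine Finset.sum_le_sum fun f _ => ?_
      rw [← integral_add (hwint t f) (hvint t f)]
      refine integral_mono (hint t f) ((hwint t f).add (hvint t f)) fun ω => ?_
      have h3 := estimate_sub_le sys t T (Nat.one_le_iff_ne_zero.2 ht0) (Finset.mem_range.1 ht)
        (run sys V solve θ Dh t ω) n f (hd f).1
      have h4 := mul_le_mul_of_nonneg_left (mul_le_mul_of_nonneg_left h3 (hx0 t f ω))
        (Nat.cast_nonneg (α := ℝ) (sys.size f))
      refine h4.trans (le_of_eq ?_)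
      simp only [w, v]
      ring
  refine (Finset.sum_le_sum hstep).trans ?_
  rw [Finset.sum_add_distrib, Finset.sum_add_distrib,
    Finset.sum_ite_eq' (Finset.range T) 0 fun _ => K * sys.cap n,
    if_pos (Finset.mem_range.2 (by omega))]
  linarith

end IsDemandModel
-- Mixed placements and the drift of the virtual queues
/-- `p` lies in the closed convex hull of the placements that respect the capacity of server `n`:
every linear inequality valid for these placements is valid for `p`. -/
def System.IsMixedPlacement (sys : System N U F) (n : N) (p : F → ℝ) : Prop :=
  ∀ (w : F → ℝ) (c : ℝ), (∀ x, sys.Fits n x → ∑ f, w f * (x f).toNat ≤ c) → ∑ f, w f * p f ≤ c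

namespace System.IsMixedPlacement

variable {sys : System N U F} {n : N} {p : F → ℝ}

theorem nonneg (hp : sys.IsMixedPlacement n p) (f : F) : 0 ≤ p f := by
  have := hp (fun g => if g = f then -1 else 0) 0 fun x _ => Finset.sum_nonpos fun g _ => by
    split_ifs <;> simp
  simpa using this

theorem sum_size_mul_le (hp : sys.IsMixedPlacement n p) :
    ∑ f, (sys.size f : ℝ) * p f ≤ sys.cap n :=
  hp _ _ fun _ hx => sum_size_mul_le_of_fits sys hx

theorem sum_le_of_isOptimal (hp : sys.IsMixedPlacement n p) {w : F → ℝ} {x : F → Bool}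
    (hx : IsOptimalPlacement sys n w x) : ∑ f, w f * p f ≤ ∑ f, w f * (x f).toNat :=
  hp _ _ hx.2

end System.IsMixedPlacement

theorem cost_nonneg (sys : System N U F) (hcost : 0 < sys.unitCost) (x : F → Bool) :
    0 ≤ sys.cost x :=
  Finset.sum_nonneg fun f _ => by positivity

theorem cost_le_of_fits (sys : System N U F) (hcost : 0 < sys.unitCost) {n : N} {x : F → Bool}
    (hx : sys.Fits n x) : sys.cost x ≤ sys.unitCost * sys.cap n := by
  unfold System.cost
  simp_rw [mul_assoc]
  rw [← Finset.mul_sum]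
  exact mul_le_mul_of_nonneg_left (sum_size_mul_le_of_fits sys hx) hcost.le

section Queue

variable (sys : System N U F) (V : ℝ) (solve : ℕ → N → (F → ℝ) → F → Bool)
  {Ω : Type*} (θ : ℕ → U → F → Ω → Bool) (Dh : (n : N) → (f : F) → Fin (sys.hist n f) → Ω → ℕ)

theorem queue_nonneg (hcost : 0 < sys.unitCost) (t : ℕ) (ω : Ω) (n : N) :
    0 ≤ (run sys V solve θ Dh t ω).queue n := by
  cases t with
  | zero => exact le_rfl
  | succ t => exact add_nonneg (le_max_right _ _) (cost_nonneg sys hcost _)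

theorem queue_succ (t : ℕ) (ω : Ω) (n : N) : (run sys V solve θ Dh (t + 1) ω).queue n
    = max ((run sys V solve θ Dh t ω).queue n - sys.budget n) 0
      + sys.cost (placement sys V solve t (run sys V solve θ Dh t ω) n) := rfl

/-- A crude bound that serves only to make the queues integrable. -/
theorem queue_le (hcost : 0 < sys.unitCost) (hbudget : ∀ n, 0 ≤ sys.budget n)
    (hsolve : ∀ t n w, IsOptimalPlacement sys n w (solve t n w)) (t : ℕ) (ω : Ω) (n : N) :
    (run sys V solve θ Dh t ω).queue n ≤ t * (sys.unitCost * sys.cap n) := by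
  induction t with
  | zero => simp [run, state]
  | succ t ih =>
    rw [queue_succ]
    have h1 := cost_le_of_fits sys hcost
      (hsolve t n (weight sys V t (run sys V solve θ Dh t ω) n)).1
    have h2 : max ((run sys V solve θ Dh t ω).queue n - sys.budget n) 0
        ≤ t * (sys.unitCost * sys.cap n) :=
      max_le (by linarith [hbudget n]) (by positivity)
    push_cast
    unfold placement
    linarith

/-- The drift inequality of the virtual queue. -/
theorem queue_sq_le (hcost : 0 < sys.unitCost) (hbudget : ∀ n, 0 ≤ sys.budget n)
    (hsolve : ∀ t n w, IsOptimalPlacement sys n w (solve t n w)) (T : ℕ) (ω : Ω) (n : N) :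
    (run sys V solve θ Dh T ω).queue n ^ 2 / 2
      ≤ T * ((sys.budget n ^ 2 + sys.unitCost ^ 2 * (sys.cap n : ℝ) ^ 2) / 2)
        + ∑ t ∈ Finset.range T, (run sys V solve θ Dh t ω).queue n *
          (sys.cost (placement sys V solve t (run sys V solve θ Dh t ω) n) - sys.budget n) := by
  induction T with
  | zero => simp [run, state]
  | succ T ih =>
    rw [Finset.sum_range_succ, queue_succ]
    have h1 : sys.cost (placement sys V solve T (run sys V solve θ Dh T ω) n)
        ≤ sys.unitCost * sys.cap n := cost_le_of_fits sys hcost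
      (hsolve T n (weight sys V T (run sys V solve θ Dh T ω) n)).1
    have h2 := cost_nonneg sys hcost (placement sys V solve T (run sys V solve θ Dh T ω) n)
    have hq := queue_nonneg sys V solve θ Dh hcost T ω n
    set q := (run sys V solve θ Dh T ω).queue n
    set c := sys.cost (placement sys V solve T (run sys V solve θ Dh T ω) n)
    have hc2 : c ^ 2 ≤ sys.unitCost ^ 2 * (sys.cap n : ℝ) ^ 2 := by
      rw [← mul_pow]; gcongr
    -- The slack is 2bc when the maximum is q - b, and (q - b)² + 2qc when it is 0.
    have hstep : (max (q - sys.budget n) 0 + c) ^ 2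
        ≤ q ^ 2 + sys.budget n ^ 2 + c ^ 2 + 2 * q * (c - sys.budget n) := by
      rcases max_cases (q - sys.budget n) 0 with ⟨e, h⟩ | ⟨e, h⟩
      · rw [e]; nlinarith [mul_nonneg h2 (hbudget n)]
      · rw [e]; nlinarith [mul_nonneg h2 hq, sq_nonneg (q - sys.budget n)]
    push_cast
    linarith

/-- Drift plus penalty: CPHBL compared with a fixed mixed placement. -/
theorem sum_estimate_mixed_le (hcost : 0 < sys.unitCost) (hbudget : ∀ n, 0 ≤ sys.budget n)
    (hsolve : ∀ t n w, IsOptimalPlacement sys n w (solve t n w)) (T : ℕ) (ω : Ω) (n : N)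
    {p : F → ℝ} (hp : sys.IsMixedPlacement n p) :
    V * ∑ t ∈ Finset.range T, ∑ f, (sys.size f : ℝ) * p f *
        estimate sys t (run sys V solve θ Dh t ω) n f
      ≤ T * ((sys.budget n ^ 2 + sys.unitCost ^ 2 * (sys.cap n : ℝ) ^ 2) / 2)
        + V * (∑ t ∈ Finset.range T, ∑ f, (sys.size f : ℝ) *
          ((placement sys V solve t (run sys V solve θ Dh t ω) n f).toNat *
            estimate sys t (run sys V solve θ Dh t ω) n f))
        + (∑ t ∈ Finset.range T, (run sys V solve θ Dh t ω).queue n) *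
          (∑ f, sys.unitCost * sys.size f * p f - sys.budget n) := by
  have h1 := queue_sq_le sys V solve θ Dh hcost hbudget hsolve T ω n
  have h2 : ∀ t, V * ∑ f, (sys.size f : ℝ) * p f * estimate sys t (run sys V solve θ Dh t ω) n f
      + (run sys V solve θ Dh t ω).queue n *
        (sys.cost (placement sys V solve t (run sys V solve θ Dh t ω) n) - sys.budget n)
      ≤ V * (∑ f, (sys.size f : ℝ) *
          ((placement sys V solve t (run sys V solve θ Dh t ω) n f).toNat *
            estimate sys t (run sys V solve θ Dh t ω) n f))
        + (run sys V solve θ Dh t ω).queue n *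
          (∑ f, sys.unitCost * sys.size f * p f - sys.budget n) := fun t => by
    -- Optimality of the placement, beyond its admissibility, enters here: a linear functional
    -- bounded on the placements is bounded on their hull.
    have h3 := hp.sum_le_of_isOptimal (hsolve t n (weight sys V t (run sys V solve θ Dh t ω) n))
    set q := (run sys V solve θ Dh t ω).queue n
    have e1 : ∑ f, weight sys V t (run sys V solve θ Dh t ω) n f * p f
        = V * (∑ f, (sys.size f : ℝ) * p f * estimate sys t (run sys V solve θ Dh t ω) n f)
          - q * ∑ f, sys.unitCost * sys.size f * p f := by
      rw [Finset.mul_sum, Finset.mul_sum, ← Finset.sum_sub_distrib]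
      exact Finset.sum_congr rfl fun f _ => by simp only [weight, q]; ring
    have e2 : ∑ f, weight sys V t (run sys V solve θ Dh t ω) n f *
          (solve t n (weight sys V t (run sys V solve θ Dh t ω) n) f).toNat
        = V * (∑ f, (sys.size f : ℝ) *
          ((placement sys V solve t (run sys V solve θ Dh t ω) n f).toNat *
            estimate sys t (run sys V solve θ Dh t ω) n f))
          - q * sys.cost (placement sys V solve t (run sys V solve θ Dh t ω) n) := by
      rw [System.cost, Finset.mul_sum, Finset.mul_sum, ← Finset.sum_sub_distrib]
      exact Finset.sum_congr rfl fun f _ => by simp only [placement, weight, q]; ring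
    rw [e1, e2] at h3
    linarith
  have h4 := Finset.sum_le_sum fun t (_ : t ∈ Finset.range T) => h2 t
  rw [Finset.sum_add_distrib, Finset.sum_add_distrib, ← Finset.mul_sum, ← Finset.mul_sum,
    ← Finset.sum_mul] at h4
  -- The final queue energy is discarded; the initial one is zero.
  have h5 : 0 ≤ (run sys V solve θ Dh T ω).queue n ^ 2 / 2 := by positivity
  linarith

end Queue

theorem integral_le_of_forall_le {Ω : Type*} [MeasurableSpace Ω] {P : Measure Ω}
    [IsProbabilityMeasure P] (v c κ : ℝ) {X Y Z : Ω → ℝ} (hX : Integrable X P)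
    (hY : Integrable Y P) (hZ : Integrable Z P) (h : ∀ ω, v * X ω ≤ c + v * Y ω + Z ω * κ) :
    v * ∫ ω, X ω ∂P ≤ c + v * ∫ ω, Y ω ∂P + (∫ ω, Z ω ∂P) * κ := by
  have i1 : Integrable (fun ω => c + v * Y ω) P := (integrable_const c).add (hY.const_mul v)
  have h1 := integral_mono (hX.const_mul v) (i1.add (hZ.mul_const κ)) h
  have h2 : ∫ ω, (c + v * Y ω + Z ω * κ) ∂P = c + v * ∫ ω, Y ω ∂P + (∫ ω, Z ω ∂P) * κ := by
    rw [integral_add i1 (hZ.mul_const κ), integral_add (integrable_const c) (hY.const_mul v),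
      integral_const_mul, integral_mul_const, integral_const]
    simp
  rw [← integral_const_mul, ← h2]
  exact h1

/-! ### Reward of one server against a mixed placement -/

namespace IsDemandModel

variable {sys : System N U F} {Ω : Type*} [MeasurableSpace Ω] {P : Measure Ω}
  [IsProbabilityMeasure P]
  {θ : ℕ → U → F → Ω → Bool} {Dh : (n : N) → (f : F) → Fin (sys.hist n f) → Ω → ℕ}
  (V : ℝ) (solve : ℕ → N → (F → ℝ) → F → Bool)

theorem integrable_placement_mul (hm : IsDemandModel sys P θ Dh) (t : ℕ) (n : N) (f : F)
    {Y : Ω → ℝ} (hY : Integrable Y P) :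
    Integrable (fun ω =>
      ((placement sys V solve t (run sys V solve θ Dh t ω) n f).toNat : ℝ) * Y ω) P :=
  hY.bdd_mul (c := 1) (hm.measurable_run V solve t fun st =>
      ((placement sys V solve t st n f).toNat : ℝ)).aestronglyMeasurable
    (Eventually.of_forall fun ω => by
      cases placement sys V solve t (run sys V solve θ Dh t ω) n f <;> simp)

/-- The placement is a function of the past, so it is independent of the demand that it is
multiplied with. -/
theorem integral_reward (hm : IsDemandModel sys P θ Dh) (t : ℕ) (n : N) :
    ∫ ω, sys.reward n (sys.demand fun k f => θ t k f ω)
        (placement sys V solve t (run sys V solve θ Dh t ω) n) ∂P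
      = ∑ f, (sys.size f : ℝ) * (meanDemand sys P θ n f *
        ∫ ω, ((placement sys V solve t (run sys V solve θ Dh t ω) n f).toNat : ℝ) ∂P) := by
  unfold System.reward
  have hint : ∀ f, Integrable (fun ω => (sys.size f : ℝ) *
      (sys.demand (fun k f => θ t k f ω) n f : ℝ) *
      ((placement sys V solve t (run sys V solve θ Dh t ω) n f).toNat : ℝ)) P := fun f => by
    have := (hm.integrable_placement_mul V solve t n f (hm.integrable_demand t n f)).const_mul
      (sys.size f : ℝ)
    refine this.congr (Eventually.of_forall fun ω => ?_)
    dsimp only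
    ring
  rw [integral_finsetSum _ fun f _ => hint f]
  refine Finset.sum_congr rfl fun f _ => ?_
  have hind := (hm.indepFun_run V solve t fun st =>
    ((placement sys V solve t st n f).toNat : ℝ)).comp measurable_id
    (Measurable.of_discrete (f := fun d : N → F → ℕ => (d n f : ℝ)))
  have := hind.integral_fun_mul_eq_mul_integral
    (hm.measurable_run V solve t fun st =>
      ((placement sys V solve t st n f).toNat : ℝ)).aestronglyMeasurable
    (hm.measurable_demand_apply t n f).aestronglyMeasurable
  simp only [Function.comp_def, id] at this
  rw [hm.integral_demand] at this
  simp_rw [mul_assoc]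
  rw [integral_const_mul, mul_comm (meanDemand sys P θ n f), ← this]
  simp_rw [mul_comm]

/-- The expected reward of a server under CPHBL, compared with a fixed mixed placement. -/
theorem sum_mean_mixed_le (hm : IsDemandModel sys P θ Dh) (hcost : 0 < sys.unitCost)
    (hbudget : ∀ n, 0 ≤ sys.budget n) (hV : 0 < V)
    (hsolve : ∀ t n w, IsOptimalPlacement sys n w (solve t n w)) (T : ℕ) (hT : 1 ≤ T) (n : N)
    {p : F → ℝ} (hp : sys.IsMixedPlacement n p) :
    T * ∑ f, (sys.size f : ℝ) * meanDemand sys P θ n f * p f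
      ≤ T * ((sys.budget n ^ 2 + sys.unitCost ^ 2 * (sys.cap n : ℝ) ^ 2) / 2) / V
        + 4 * (sys.numUsers n * sys.cap n)
        + 2 * (sys.numUsers n * Real.sqrt (6 * sys.cap n * ∑ f, (sys.size f : ℝ))) *
          Real.sqrt (Real.log T / ((T : ℝ) + sys.histMin)) * T
        + ∑ t ∈ Finset.range T, ∫ ω, sys.reward n (sys.demand fun k f => θ t k f ω)
          (placement sys V solve t (run sys V solve θ Dh t ω) n) ∂P
        + (∑ t ∈ Finset.range T, ∫ ω, (run sys V solve θ Dh t ω).queue n ∂P) / V *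
          (∑ f, sys.unitCost * sys.size f * p f - sys.budget n) := by
  set B := (sys.budget n ^ 2 + sys.unitCost ^ 2 * (sys.cap n : ℝ) ^ 2) / 2
  set κ := ∑ f, sys.unitCost * sys.size f * p f - sys.budget n
  have hei := fun t f => hm.integrable_estimate V solve t n f
  have hxe := fun t f => hm.integrable_placement_mul V solve t n f (hei t f)
  have hx1 : ∀ t f, Integrable (fun ω =>
      ((placement sys V solve t (run sys V solve θ Dh t ω) n f).toNat : ℝ)) P := fun t f => by
    simpa using hm.integrable_placement_mul V solve t n f (integrable_const (1 : ℝ))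
  have hqi : ∀ t, Integrable (fun ω => (run sys V solve θ Dh t ω).queue n) P := fun t =>
    Integrable.of_mem_Icc 0 (t * (sys.unitCost * sys.cap n))
      (hm.measurable_run V solve t fun st => st.queue n).aemeasurable
      (Eventually.of_forall fun ω => ⟨queue_nonneg sys V solve θ Dh hcost t ω n,
        queue_le sys V solve θ Dh hcost hbudget hsolve t ω n⟩)
  have i1 : Integrable (fun ω => ∑ t ∈ Finset.range T, ∑ f, (sys.size f : ℝ) * p f *
      estimate sys t (run sys V solve θ Dh t ω) n f) P :=
    integrable_finsetSum _ fun t _ => integrable_finsetSum _ fun f _ => (hei t f).const_mul _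
  have i2 : Integrable (fun ω => ∑ t ∈ Finset.range T, ∑ f, (sys.size f : ℝ) *
      ((placement sys V solve t (run sys V solve θ Dh t ω) n f).toNat *
        estimate sys t (run sys V solve θ Dh t ω) n f)) P :=
    integrable_finsetSum _ fun t _ => integrable_finsetSum _ fun f _ => (hxe t f).const_mul _
  have i3 : Integrable (fun ω => ∑ t ∈ Finset.range T, (run sys V solve θ Dh t ω).queue n) P :=
    integrable_finsetSum _ fun t _ => hqi t
  have hE := integral_le_of_forall_le V (T * B) κ i1 i2 i3
    fun ω => sum_estimate_mixed_le sys V solve θ Dh hcost hbudget hsolve T ω n hp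
  rw [integral_finsetSum _ fun t _ => hqi t,
    integral_finsetSum _ fun t _ => integrable_finsetSum _ fun f _ => (hei t f).const_mul _,
    integral_finsetSum _ fun t _ => integrable_finsetSum _ fun f _ => (hxe t f).const_mul _,
    Finset.sum_congr rfl fun t _ => integral_finsetSum _ fun f _ => (hei t f).const_mul _,
    Finset.sum_congr rfl fun t _ => integral_finsetSum _ fun f _ => (hxe t f).const_mul _] at hE
  simp only [integral_const_mul] at hE
  -- Each file loses at most 3K over all slots, and the capacity bound for `p` turns the weighted
  -- total into 3K times the capacity. The fourth multiple comes from slot 0 in `hup`.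
  have hlow : T * ∑ f, (sys.size f : ℝ) * meanDemand sys P θ n f * p f
      - 3 * (sys.numUsers n * sys.cap n)
      ≤ ∑ t ∈ Finset.range T, ∑ f, (sys.size f : ℝ) * p f *
        ∫ ω, estimate sys t (run sys V solve θ Dh t ω) n f ∂P := by
    have h1 : ∀ f, T * meanDemand sys P θ n f - 3 * sys.numUsers n
        ≤ ∑ t ∈ Finset.range T, ∫ ω, estimate sys t (run sys V solve θ Dh t ω) n f ∂P := by
      intro f
      have h2 := hm.sum_integral_sub_estimate_le V solve n f T
      have h3 : ∀ t, ∫ ω, (meanDemand sys P θ n f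
          - estimate sys t (run sys V solve θ Dh t ω) n f) ∂P = meanDemand sys P θ n f
          - ∫ ω, estimate sys t (run sys V solve θ Dh t ω) n f ∂P := fun t => by
        rw [integral_sub (integrable_const _) (hei t f)]; simp
      simp only [h3, Finset.sum_sub_distrib, Finset.sum_const, Finset.card_range,
        nsmul_eq_mul] at h2
      linarith
    rw [Finset.sum_comm]
    simp_rw [← Finset.mul_sum]
    calc _ ≤ T * ∑ f, (sys.size f : ℝ) * meanDemand sys P θ n f * p f
          - 3 * sys.numUsers n * ∑ f, (sys.size f : ℝ) * p f := by
          have := mul_le_mul_of_nonneg_left hp.sum_size_mul_le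
            (show (0 : ℝ) ≤ 3 * sys.numUsers n by positivity)
          linarith
      _ = ∑ f, (sys.size f : ℝ) * p f * (T * meanDemand sys P θ n f - 3 * sys.numUsers n) := by
          rw [Finset.mul_sum, Finset.mul_sum, ← Finset.sum_sub_distrib]
          exact Finset.sum_congr rfl fun f _ => by ring
      _ ≤ _ := Finset.sum_le_sum fun f _ =>
          mul_le_mul_of_nonneg_left (h1 f) (mul_nonneg (Nat.cast_nonneg _) (hp.nonneg f))
  have hup := hm.sum_integral_estimate_sub_le V solve hsolve n T hT
  have hsplit : ∀ t f, ∫ ω, (sys.size f : ℝ) *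
      ((placement sys V solve t (run sys V solve θ Dh t ω) n f).toNat *
        (estimate sys t (run sys V solve θ Dh t ω) n f - meanDemand sys P θ n f)) ∂P
      = (sys.size f : ℝ) *
        (∫ ω, ((placement sys V solve t (run sys V solve θ Dh t ω) n f).toNat : ℝ) *
          estimate sys t (run sys V solve θ Dh t ω) n f ∂P)
      - (sys.size f : ℝ) * (meanDemand sys P θ n f *
        ∫ ω, ((placement sys V solve t (run sys V solve θ Dh t ω) n f).toNat : ℝ) ∂P) := by
    intro t f
    rw [integral_const_mul, ← mul_sub, ← integral_const_mul (meanDemand sys P θ n f),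
      ← integral_sub (hxe t f) ((hx1 t f).const_mul _)]
    congr 2
    funext ω
    ring
  simp only [hsplit, Finset.sum_sub_distrib, ← hm.integral_reward V solve] at hup
  have hfin := (mul_le_mul_of_nonneg_left hlow hV.le).trans hE
  set A := ∑ t ∈ Finset.range T, ∑ f, (sys.size f : ℝ) *
    ∫ ω, ((placement sys V solve t (run sys V solve θ Dh t ω) n f).toNat : ℝ) *
      estimate sys t (run sys V solve θ Dh t ω) n f ∂P
  set S := ∑ t ∈ Finset.range T, ∫ ω, (run sys V solve θ Dh t ω).queue n ∂P
  have e : T * B + V * A + S * κ = V * (T * B / V + A + S / V * κ) := by field_simp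
  rw [e] at hfin
  have := le_of_mul_le_mul_left hfin hV
  linarith

end IsDemandModel
-- Feasible schemes and weak duality
/-- The caching frequencies of a scheme, averaged over the first `t` slots. -/
def averagePlacement {Ω : Type*} [MeasurableSpace Ω] (P : Measure Ω)
    (X : ℕ → Ω → N → F → Bool) (t : ℕ) (n : N) (f : F) : ℝ :=
  (1 / (t : ℝ)) * ∑ τ ∈ Finset.range t, ∫ ω, ((X τ ω n f).toNat : ℝ) ∂P

namespace IsFeasibleScheme

variable {sys : System N U F} {μ : Measure (N → F → ℕ)} {Ω : Type} [MeasurableSpace Ω]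
  {P : Measure Ω} {D : ℕ → Ω → N → F → ℕ} {X : ℕ → Ω → N → F → Bool}

theorem measurable_toNat (hX : IsFeasibleScheme sys μ P D X) (t : ℕ) (n : N) (f : F) :
    Measurable fun ω => ((X t ω n f).toNat : ℝ) :=
  (Measurable.of_discrete (f := fun x : N → F → Bool => ((x n f).toNat : ℝ))).comp
    (hX.measurable_placement t)

variable [IsProbabilityMeasure P]

theorem integrable_toNat (hX : IsFeasibleScheme sys μ P D X) (t : ℕ) (n : N) (f : F) :
    Integrable (fun ω => ((X t ω n f).toNat : ℝ)) P :=
  Integrable.of_bound (hX.measurable_toNat t n f).aestronglyMeasurable 1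
    (Eventually.of_forall fun ω => by cases X t ω n f <;> simp)

/-- Expectations and time averages preserve linear inequalities; describing the hull by inequalities
makes this immediate. -/
theorem isMixedPlacement (hX : IsFeasibleScheme sys μ P D X) {t : ℕ} (ht : 0 < t) (n : N) :
    sys.IsMixedPlacement n (averagePlacement P X t n) := by
  intro w c hc
  have ht' : (0 : ℝ) < t := by exact_mod_cast ht
  have h1 : ∀ τ, ∑ f, w f * ∫ ω, ((X τ ω n f).toNat : ℝ) ∂P ≤ c := fun τ => by
    simp_rw [← integral_const_mul]
    rw [← integral_finsetSum _ fun f _ => (hX.integrable_toNat τ n f).const_mul _]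
    have := integral_mono (integrable_finsetSum _ fun f (_ : f ∈ Finset.univ) =>
      (hX.integrable_toNat τ n f).const_mul (w f)) (integrable_const (μ := P) c)
      fun ω => hc _ (hX.fits τ ω n)
    simpa using this
  calc ∑ f, w f * averagePlacement P X t n f
      = (1 / (t : ℝ)) * ∑ τ ∈ Finset.range t, ∑ f, w f * ∫ ω, ((X τ ω n f).toNat : ℝ) ∂P := by
        rw [Finset.sum_comm, Finset.mul_sum]
        refine Finset.sum_congr rfl fun f _ => ?_
        rw [averagePlacement, ← Finset.mul_sum]; ring
    _ ≤ (1 / (t : ℝ)) * ∑ τ ∈ Finset.range t, c := by gcongr; exact h1 _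
    _ = c := by simp; field_simp

theorem average_cost_eq (hX : IsFeasibleScheme sys μ P D X) (t : ℕ) (n : N) :
    (1 / (t : ℝ)) * ∑ τ ∈ Finset.range t, ∫ ω, sys.cost (X τ ω n) ∂P
      = ∑ f, sys.unitCost * sys.size f * averagePlacement P X t n f := by
  unfold System.cost averagePlacement
  simp_rw [integral_finsetSum _ fun f _ => (hX.integrable_toNat _ n f).const_mul _,
    integral_const_mul]
  rw [Finset.sum_comm, Finset.mul_sum]
  refine Finset.sum_congr rfl fun f _ => ?_
  rw [← Finset.mul_sum]; ring

/-- Of the causality assumption, only the independence of the demand and the placement within slot t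
is used. -/
theorem integral_reward (hX : IsFeasibleScheme sys μ P D X) {d : N → F → ℝ}
    (hint : ∀ n f, Integrable (fun D : N → F → ℕ => (D n f : ℝ)) μ)
    (hd : ∀ n f, ∫ D : N → F → ℕ, (D n f : ℝ) ∂μ = d n f) (t : ℕ) (n : N) :
    ∫ ω, sys.reward n (D t ω) (X t ω n) ∂P
      = ∑ f, (sys.size f : ℝ) * d n f * ∫ ω, ((X t ω n f).toNat : ℝ) ∂P := by
  have hDi : ∀ f, Integrable (fun ω => (D t ω n f : ℝ)) P := fun f => by
    have := hint n f
    rw [← hX.law t] at this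
    exact this.comp_measurable (hX.measurable_demand t)
  have hDe : ∀ f, ∫ ω, (D t ω n f : ℝ) ∂P = d n f := fun f => by
    rw [← hd n f, ← hX.law t, integral_map (hX.measurable_demand t).aemeasurable
      (Measurable.of_discrete (f := fun D : N → F → ℕ => (D n f : ℝ))).aestronglyMeasurable]
  have hind : ∀ f, IndepFun (fun ω => (D t ω n f : ℝ)) (fun ω => ((X t ω n f).toNat : ℝ)) P :=
    fun f => (hX.causal t).comp (φ := fun D : N → F → ℕ => (D n f : ℝ))
      (ψ := fun q : (Fin t → N → F → ℕ) × (Fin (t + 1) → N → F → Bool) =>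
        ((q.2 (Fin.last t) n f).toNat : ℝ)) Measurable.of_discrete
      ((Measurable.of_discrete (f := fun x : N → F → Bool => ((x n f).toNat : ℝ))).comp
        ((measurable_pi_apply (Fin.last t)).comp measurable_snd))
  have hprod : ∀ f, Integrable (fun ω => (D t ω n f : ℝ) * ((X t ω n f).toNat : ℝ)) P := fun f =>
    (hind f).integrable_mul (hDi f) (hX.integrable_toNat t n f)
  unfold System.reward
  simp_rw [mul_assoc]
  rw [integral_finsetSum _ fun f _ => (hprod f).const_mul (sys.size f : ℝ)]
  refine Finset.sum_congr rfl fun f _ => ?_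
  rw [integral_const_mul, (hind f).integral_fun_mul_eq_mul_integral (hDi f).aestronglyMeasurable
    (hX.integrable_toNat t n f).aestronglyMeasurable, hDe]

theorem average_reward_eq (hX : IsFeasibleScheme sys μ P D X) {d : N → F → ℝ}
    (hint : ∀ n f, Integrable (fun D : N → F → ℕ => (D n f : ℝ)) μ)
    (hd : ∀ n f, ∫ D : N → F → ℕ, (D n f : ℝ) ∂μ = d n f) (t : ℕ) :
    (1 / (t : ℝ)) * ∑ τ ∈ Finset.range t, ∑ n, ∫ ω, sys.reward n (D τ ω) (X τ ω n) ∂P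
      = ∑ n, ∑ f, (sys.size f : ℝ) * d n f * averagePlacement P X t n f := by
  simp_rw [hX.integral_reward hint hd]
  rw [Finset.sum_comm, Finset.mul_sum]
  refine Finset.sum_congr rfl fun n _ => ?_
  rw [Finset.sum_comm, Finset.mul_sum]
  refine Finset.sum_congr rfl fun f _ => ?_
  rw [← Finset.mul_sum, averagePlacement]; ring

end IsFeasibleScheme

/-- Lagrangian upper bound of the optimal time-averaged reward. -/
theorem optReward_le (sys : System N U F) (hcost : 0 < sys.unitCost) {μ : Measure (N → F → ℕ)}
    {d : N → F → ℝ} (hint : ∀ n f, Integrable (fun D : N → F → ℕ => (D n f : ℝ)) μ)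
    (hd : ∀ n f, ∫ D : N → F → ℕ, (D n f : ℝ) ∂μ = d n f) (A : ℝ) (hA : 0 ≤ A) (C : N → ℝ)
    (hC : ∀ n, 0 ≤ C n)
    (hp : ∀ p : N → F → ℝ, (∀ n, sys.IsMixedPlacement n (p n)) →
      ∑ n, ∑ f, (sys.size f : ℝ) * d n f * p n f
        ≤ A + ∑ n, C n * (∑ f, sys.unitCost * sys.size f * p n f - sys.budget n)) :
    optReward sys μ ≤ A := by
  -- With A ≥ 0 the default value `sSup ∅ = 0` is covered, so no feasible scheme has to be
  -- exhibited.
  refine Real.sSup_le ?_ hA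
  rintro v ⟨Ω, _, P, _, D, X, hX, rfl⟩
  simp_rw [hX.average_reward_eq hint hd]
  have hd0 : ∀ n f, 0 ≤ d n f := fun n f => by
    rw [← hd]; exact integral_nonneg fun D => Nat.cast_nonneg _
  have havg0 : ∀ t n f, 0 ≤ averagePlacement P X t n f := fun t n f =>
    mul_nonneg (by positivity) (Finset.sum_nonneg fun τ _ => integral_nonneg fun ω =>
      Nat.cast_nonneg _)
  have hbudget : ∀ n, ∀ δ > 0, ∀ᶠ t in atTop,
      ∑ f, sys.unitCost * sys.size f * averagePlacement P X t n f < sys.budget n + δ := by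
    intro n δ hδ
    have h1 := hX.budget_le n
    simp_rw [hX.average_cost_eq] at h1
    -- For real sequences this passage needs boundedness from above, which the capacity provides.
    refine eventually_lt_of_limsup_lt (h1.trans_lt (lt_add_of_pos_right _ hδ)) ?_
    refine isBoundedUnder_of_eventually_le (a := sys.unitCost * sys.cap n) ?_
    filter_upwards [eventually_gt_atTop 0] with t ht
    simp_rw [mul_assoc]
    rw [← Finset.mul_sum]
    exact mul_le_mul_of_nonneg_left (hX.isMixedPlacement ht n).sum_size_mul_le hcost.le
  have hcob : IsCoboundedUnder (· ≤ ·) atTop fun t : ℕ =>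
      ∑ n, ∑ f, (sys.size f : ℝ) * d n f * averagePlacement P X t n f := by
    refine IsBoundedUnder.isCoboundedUnder_le (isBoundedUnder_of ⟨0, fun t => ?_⟩)
    exact Finset.sum_nonneg fun n _ => Finset.sum_nonneg fun f _ =>
      mul_nonneg (mul_nonneg (Nat.cast_nonneg _) (hd0 n f)) (havg0 t n f)
  have key : ∀ δ > 0, limsup (fun t : ℕ =>
      ∑ n, ∑ f, (sys.size f : ℝ) * d n f * averagePlacement P X t n f) atTop
      ≤ A + δ * ∑ n, C n := by
    intro δ hδ
    refine limsup_le_of_le hcob ?_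
    filter_upwards [eventually_gt_atTop 0, eventually_all.2 fun n => hbudget n δ hδ] with t ht hb
    refine (hp _ fun n => hX.isMixedPlacement ht n).trans ?_
    rw [mul_comm δ, Finset.sum_mul]
    exact add_le_add_right (Finset.sum_le_sum fun n _ =>
      mul_le_mul_of_nonneg_left (by linarith [hb n]) (hC n)) _
  have hS : 0 ≤ ∑ n, C n := Finset.sum_nonneg fun n _ => hC n
  -- The summand 1 in the denominator covers the case in which all multipliers vanish.
  refine le_of_forall_pos_le_add fun ε hε => (key (ε / (∑ n, C n + 1)) (by positivity)).trans ?_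
  gcongr
  rw [div_mul_eq_mul_div, div_le_iff₀ (by positivity)]
  nlinarith

theorem sum_server_bounds (a k g r S κ : N → ℝ) (V T q : ℝ) (hT : T ≠ 0) :
    ∑ n, (T * a n / V + 4 * k n + 2 * g n * q * T + r n + S n / V * κ n)
      = T * ((∑ n, a n) / V + 4 * (∑ n, k n) / T + (2 * ∑ n, g n) * q + 1 / T * ∑ n, r n
        + ∑ n, S n / V / T * κ n) := by
  simp only [Finset.mul_sum, Finset.sum_div, Finset.sum_mul, ← Finset.sum_add_distrib]
  refine Finset.sum_congr rfl fun n _ => ?_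
  field_simp

end FogCache

end

/-! ### The regret bound -/

theorem theorem2 {N U F : Type*} [Fintype N] [Fintype U] [Fintype F]
    [DecidableEq N] [DecidableEq F] [Nonempty N] [Nonempty F]
    (sys : FogCache.System N U F)
    (hcost : 0 < sys.unitCost) (hbudget : ∀ n, 0 ≤ sys.budget n)
    {Ω : Type*} [MeasurableSpace Ω] (P : MeasureTheory.Measure Ω)
    [MeasureTheory.IsProbabilityMeasure P]
    (θ : ℕ → U → F → Ω → Bool) (Dh : (n : N) → (f : F) → Fin (sys.hist n f) → Ω → ℕ)
    (hmodel : FogCache.IsDemandModel sys P θ Dh)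
    (V : ℝ) (hV : 0 < V)
    (solve : ℕ → N → (F → ℝ) → F → Bool)
    (hsolve : ∀ t n w, FogCache.IsOptimalPlacement sys n w (solve t n w))
    (T : ℕ) (hT : 1 ≤ T) :
    FogCache.regret sys P (fun t ω => sys.demand fun k f => θ t k f ω)
        (fun t ω => FogCache.cphbl sys V solve (fun n f s => Dh n f s ω)
          (fun τ => sys.demand fun k f => θ τ k f ω) t) T
      ≤ (∑ n, (sys.budget n ^ 2 + sys.unitCost ^ 2 * (sys.cap n : ℝ) ^ 2) / 2) / V
        + 4 * (∑ n, (sys.numUsers n : ℝ) * sys.cap n) / T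
        + (2 * ∑ n, (sys.numUsers n : ℝ) * Real.sqrt (6 * sys.cap n * ∑ f, (sys.size f : ℝ)))
          * Real.sqrt (Real.log T / ((T : ℝ) + sys.histMin)) := by
  have hT' : (0 : ℝ) < T := by exact_mod_cast hT
  have hDm := hmodel.measurable_demand 0
  have hDa : ∀ n f, Measurable fun D : N → F → ℕ => (D n f : ℝ) := fun n f => Measurable.of_discrete
  set reg := (∑ n, (sys.budget n ^ 2 + sys.unitCost ^ 2 * (sys.cap n : ℝ) ^ 2) / 2) / V
        + 4 * (∑ n, (sys.numUsers n : ℝ) * sys.cap n) / T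
        + (2 * ∑ n, (sys.numUsers n : ℝ) * Real.sqrt (6 * sys.cap n * ∑ f, (sys.size f : ℝ)))
          * Real.sqrt (Real.log T / ((T : ℝ) + sys.histMin)) with hreg
  have hreg0 : 0 ≤ reg := by positivity
  set R : ℕ → N → ℝ := fun t n => ∫ ω, sys.reward n (sys.demand fun k f => θ t k f ω)
    (FogCache.placement sys V solve t (FogCache.run sys V solve θ Dh t ω) n) ∂P with hR
  have hR0 : ∀ t n, 0 ≤ R t n := fun t n => MeasureTheory.integral_nonneg fun ω =>
    Finset.sum_nonneg fun f _ => by positivity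
  refine sub_le_iff_le_add.2 ?_
  -- The multiplier of a server is the coefficient of its budget violation in `sum_mean_mixed_le`,
  -- divided by T: the mean expected queue over V.
  refine FogCache.optReward_le sys hcost (d := FogCache.meanDemand sys P θ) (fun n f => ?_)
    (fun n f => ?_) _ (add_nonneg hreg0 (mul_nonneg (by positivity) (Finset.sum_nonneg fun t _ =>
      Finset.sum_nonneg fun n _ => hR0 t n)))
    (fun n => (∑ t ∈ Finset.range T,
      ∫ ω, (FogCache.run sys V solve θ Dh t ω).queue n ∂P) / V / T) (fun n => ?_) fun p hp => ?_
  · exact (MeasureTheory.integrable_map_measure (hDa n f).aestronglyMeasurable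
      hDm.aemeasurable).2 (hmodel.integrable_demand 0 n f)
  · rw [MeasureTheory.integral_map hDm.aemeasurable (hDa n f).aestronglyMeasurable]
    rfl
  · have : 0 ≤ ∑ t ∈ Finset.range T, ∫ ω, (FogCache.run sys V solve θ Dh t ω).queue n ∂P :=
      Finset.sum_nonneg fun t _ => MeasureTheory.integral_nonneg fun ω =>
        FogCache.queue_nonneg sys V solve θ Dh hcost t ω n
    positivity
  · have h1 := Finset.sum_le_sum fun n (_ : n ∈ Finset.univ) =>
      hmodel.sum_mean_mixed_le V solve hcost hbudget hV hsolve T hT n (hp n)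
    -- The placements in `regret` are those of `run` by definition, so the average reward is that of
    -- `R`.
    change _ ≤ reg + 1 / (T : ℝ) * ∑ t ∈ Finset.range T, ∑ n, R t n + _
    refine le_of_mul_le_mul_left ?_ hT'
    rw [Finset.mul_sum, Finset.sum_comm (s := Finset.range T)]
    exact h1.trans_eq (FogCache.sum_server_bounds _ _ _ _ _ _ V T _ hT'.ne')
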